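/- Let $\alpha>0$, $b>0$, $a\in\mathbb{R}$ and $H\neq 0$. Let $X_A=\{u\in H^1(\mathbb{R};\mathbb{C}) : xu\in L^2(\mathbb{R})\}$, $Au=u_{xx}-H^2x^2u$ and $D(A)=\{u\in X_A : Au\in L^2(\mathbb{R})\}$, with the graph norm. Consider the semilinear Cauchy problem on $\mathbb{R}$ $$ i u_t+u_{xx}=-\rho u+a|u|^2u+H^2x^2u,\qquad \rho_{tt}=\alpha\rho_{xx}-b\rho+|u|^2, $$ $$ u(\cdot,0)=u_0,\qquad \rho(\cdot,0)=\rho_0,\qquad \rho_t(\cdot,0)=\rho_1, $$ with complex-valued $u$ and real-valued $\rho$, where $(u_0,\rho_0,\rho_1)\in D(A)\times H^3(\mathbb{R})\times H^2(\mathbb{R})$. Let $\theta>0$, $D=\,]-\theta,\theta[$ and $B(0,\delta)=\{x\in\mathbb{R}:|x|<\delta\}$. Then, for all $t>0$, $\varepsilon>0$, $M\ge 0$ and $R\ge 0$, there is a $\delta>0$, depending only on $t,\varepsilon,M,R,\theta$ and on the coefficients $\alpha,a,b,H$, with the following property. For all such initial data $u_0,\rho_0,\rho_1$ vanishing almost everywhere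 outside $D$ (in particular, whenever their supports are contained in $D$) and satisfying $\|u_0\|_{H^1}\le M$, $\|\rho_0\|_{H^1}\le R$ and $\|\rho_1\|_{L^2}\le R$, every global solution $$u\in C([0,\infty);D(A))\cap C^1([0,\infty);L^2),\qquad \rho\in C([0,\infty);H^3)\cap C^1([0,\infty);H^2)\cap C^2([0,\infty);H^1)$$ of the Cauchy problem satisfies $$\int_{\mathbb{R}\setminus(D+B(0,\delta))}\big[|u|^2+|\rho|^2+|\rho_x|^2+|\rho_t|^2\big](x,t)\,dx\le\varepsilon .$$ -/

import Mathlib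

open MeasureTheory Set
open scoped ContDiff NNReal ENNReal Pointwise

noncomputable section

namespace LiquidCrystal

/-- `L²(ℝ; E)`, with respect to Lebesgue measure. -/
abbrev L2 (E : Type) [NormedAddCommGroup E] := Lp E 2 (volume : Measure ℝ)

/-- Test functions on the line: smooth with compact support. -/
def IsTest (φ : ℝ → ℝ) : Prop := ContDiff ℝ ∞ φ ∧ HasCompactSupport φ

/-- `g` is the weak (distributional) derivative of `f`. -/
def IsWeakDeriv {E : Type} [NormedAddCommGroup E] [NormedSpace ℝ E] (f g : L2 E) : Prop :=
  ∀ φ : ℝ → ℝ, IsTest φ → ∫ x, deriv φ x • f x = - ∫ x, φ x • g x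

section Helpers

variable {E : Type} [NormedAddCommGroup E] [NormedSpace ℝ E]

theorem integrable_smul_L2 {ψ : ℝ → ℝ} (hc : Continuous ψ) (hs : HasCompactSupport ψ)
    (f : L2 E) : Integrable (fun x => ψ x • f x) :=
  memLp_one_iff_integrable.1 (MemLp.smul (p := 2) (q := 2) (r := 1) (Lp.memLp f) (hc.memLp_of_hasCompactSupport hs))

theorem integral_smul_add {ψ : ℝ → ℝ} (hc : Continuous ψ) (hs : HasCompactSupport ψ)
    (f g : L2 E) :
    ∫ x, ψ x • (f + g : L2 E) x = (∫ x, ψ x • f x) + ∫ x, ψ x • g x := by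
  rw [← integral_add (integrable_smul_L2 hc hs f) (integrable_smul_L2 hc hs g)]
  refine integral_congr_ae ?_
  filter_upwards [Lp.coeFn_add f g] with x hx
  rw [hx, Pi.add_apply, smul_add]

theorem integral_smul_smul (ψ : ℝ → ℝ) (c : ℝ) (f : L2 E) :
    ∫ x, ψ x • (c • f : L2 E) x = c • ∫ x, ψ x • f x := by
  rw [← integral_smul]
  refine integral_congr_ae ?_
  filter_upwards [Lp.coeFn_smul c f] with x hx
  rw [hx, Pi.smul_apply, smul_comm]

theorem integral_smul_zero (ψ : ℝ → ℝ) : ∫ x, ψ x • (0 : L2 E) x = 0 := by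
  have h := integral_smul_smul ψ 0 (0 : L2 E)
  rwa [zero_smul, zero_smul] at h

theorem IsTest.continuous {φ : ℝ → ℝ} (h : IsTest φ) : Continuous φ := h.1.continuous

theorem IsTest.deriv {φ : ℝ → ℝ} (h : IsTest φ) : IsTest (deriv φ) :=
  ⟨((contDiff_infty_iff_deriv (𝕜 := ℝ)).1 h.1).2, h.2.deriv⟩

theorem IsWeakDeriv.zero : IsWeakDeriv (0 : L2 E) 0 := by
  intro φ _
  rw [integral_smul_zero, integral_smul_zero, neg_zero]

theorem IsWeakDeriv.add {f g f' g' : L2 E} (h : IsWeakDeriv f f') (k : IsWeakDeriv g g') :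
    IsWeakDeriv (f + g) (f' + g') := by
  intro φ hφ
  rw [integral_smul_add hφ.deriv.continuous hφ.deriv.2, integral_smul_add hφ.continuous hφ.2,
    h φ hφ, k φ hφ, neg_add]

theorem IsWeakDeriv.smul {f f' : L2 E} (c : ℝ) (h : IsWeakDeriv f f') :
    IsWeakDeriv (c • f) (c • f') := by
  intro φ hφ
  rw [integral_smul_smul, integral_smul_smul, h φ hφ, smul_neg]

end Helpers

/-- The Sobolev space `Hᵏ(ℝ; E)`, as a space of tuples: an element `f` is recorded as the tuple `(f, f', …, f⁽ᵏ⁾)` of its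
weak derivatives, all in `L²`. Since `f` determines the tuple, this is the usual space, with the
norm `(∑ j ≤ k, ‖f⁽ʲ⁾‖₂²)^(1/2)`. -/
def sobolevTuples (E : Type) [NormedAddCommGroup E] [NormedSpace ℝ E] (k : ℕ) :
    Submodule ℝ (PiLp 2 fun _ : Fin (k + 1) => L2 E) where
  carrier := {F | ∀ j : Fin k, IsWeakDeriv (F j.castSucc) (F j.succ)}
  zero_mem' := fun _ => IsWeakDeriv.zero
  add_mem' := fun hF hG j => (hF j).add (hG j)
  smul_mem' := fun c _ hF j => (hF j).smul c

/-- The Sobolev space `Hᵏ(ℝ; E)` with its usual norm. -/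
abbrev Sobolev (E : Type) [NormedAddCommGroup E] [NormedSpace ℝ E] (k : ℕ) : Type :=
  sobolevTuples E k

section SobolevBasics

variable {E : Type} [NormedAddCommGroup E] [NormedSpace ℝ E]

/-- The `j`-th weak derivative, `j ≤ k`, of an element of `Hᵏ`. -/
def Sobolev.D {k : ℕ} (F : Sobolev E k) (j : Fin (k + 1)) : L2 E := F.1 j

/-- The underlying `L²` function of an element of `Hᵏ`. -/
def Sobolev.fn {k : ℕ} (F : Sobolev E k) : L2 E := F.D 0

/-- The inclusion `Hᵏ ⊆ Hᵐ` for `m ≤ k`. -/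
def Sobolev.incl {k m : ℕ} (h : m ≤ k) (F : Sobolev E k) : Sobolev E m :=
  ⟨WithLp.toLp 2 fun j => F.1 (Fin.castLE (Nat.succ_le_succ h) j),
    fun j => F.2 (Fin.castLE h j)⟩

/-- The `Hᵏ` norm of an `L²` function, with value `∞` when it does not belong to `Hᵏ`
(the infimum is over at most one element). -/
def sobolevNorm (k : ℕ) (f : L2 E) : ℝ≥0∞ := ⨅ (F : Sobolev E k) (_ : F.fn = f), ‖F‖ₑ

end SobolevBasics

/-- `u ∈ X_A`, that is `u ∈ H¹(ℝ)` and `x u ∈ L²(ℝ)`. -/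
def MemXA (u : L2 ℂ) : Prop :=
  (∃ v : L2 ℂ, IsWeakDeriv u v) ∧ MemLp (fun x : ℝ => (x : ℂ) * u x) 2 volume

/-- `w = u_xx - H² x² u` in the sense of distributions. -/
def IsHermite (H : ℝ) (u w : L2 ℂ) : Prop :=
  ∀ φ : ℝ → ℝ, IsTest φ →
    ∫ x, (deriv (deriv φ) x - H ^ 2 * x ^ 2 * φ x) • u x = ∫ x, φ x • w x

section DomainHelpers

theorem MemXA.zero : MemXA 0 := by
  refine ⟨⟨0, IsWeakDeriv.zero⟩, ?_⟩
  refine MemLp.ae_eq ?_ (MemLp.zero (ε := ℂ))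
  filter_upwards [Lp.coeFn_zero ℂ 2 (volume : Measure ℝ)] with x hx
  rw [hx, Pi.zero_apply, mul_zero]

theorem MemXA.add {u v : L2 ℂ} (hu : MemXA u) (hv : MemXA v) : MemXA (u + v) := by
  obtain ⟨⟨u', hu'⟩, hu⟩ := hu
  obtain ⟨⟨v', hv'⟩, hv⟩ := hv
  refine ⟨⟨u' + v', hu'.add hv'⟩, (hu.add hv).ae_eq ?_⟩
  filter_upwards [Lp.coeFn_add u v] with x hx
  rw [hx, Pi.add_apply, Pi.add_apply, mul_add]

theorem MemXA.smul {u : L2 ℂ} (c : ℝ) (hu : MemXA u) : MemXA (c • u) := by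
  obtain ⟨⟨u', hu'⟩, hu⟩ := hu
  refine ⟨⟨c • u', hu'.smul c⟩, (hu.const_smul c).ae_eq ?_⟩
  filter_upwards [Lp.coeFn_smul c u] with x hx
  rw [hx, Pi.smul_apply, Pi.smul_apply, mul_smul_comm]

theorem hermite_test (H : ℝ) {φ : ℝ → ℝ} (hφ : IsTest φ) :
    Continuous (fun x => deriv (deriv φ) x - H ^ 2 * x ^ 2 * φ x) ∧
      HasCompactSupport (fun x => deriv (deriv φ) x - H ^ 2 * x ^ 2 * φ x) := by
  have h1 := hφ.deriv.deriv.continuous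
  have h2 := hφ.continuous
  refine ⟨by fun_prop, ?_⟩
  exact hφ.deriv.deriv.2.sub (hφ.2.mul_left (f := fun x => H ^ 2 * x ^ 2))

end DomainHelpers

/-- The domain `D(A) = {u ∈ X_A | A u ∈ L²}` of `A u = u_xx - H² x² u`, with its graph norm
`(‖u‖₂² + ‖A u‖₂²)^(1/2)`: an element is recorded as the pair `(u, A u)`. -/
def graphA (H : ℝ) : Submodule ℝ (WithLp 2 (L2 ℂ × L2 ℂ)) where
  carrier := {p | MemXA p.fst ∧ IsHermite H p.fst p.snd}
  zero_mem' := by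
    refine ⟨MemXA.zero, fun φ _ => ?_⟩
    exact (integral_smul_zero _).trans (integral_smul_zero _).symm
  add_mem' := by
    intro p q hp hq
    refine ⟨hp.1.add hq.1, fun φ hφ => ?_⟩
    have h := hermite_test H hφ
    have e1 := integral_smul_add h.1 h.2 p.fst q.fst
    have e2 := integral_smul_add hφ.continuous hφ.2 p.snd q.snd
    exact e1.trans ((congrArg₂ (· + ·) (hp.2 φ hφ) (hq.2 φ hφ)).trans e2.symm)
  smul_mem' := by
    intro c p hp
    refine ⟨hp.1.smul c, fun φ hφ => ?_⟩
    have e1 := integral_smul_smul (fun x => deriv (deriv φ) x - H ^ 2 * x ^ 2 * φ x) c p.fst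
    have e2 := integral_smul_smul φ c p.snd
    exact e1.trans ((congrArg (c • ·) (hp.2 φ hφ)).trans e2.symm)

/-- The space `D(A)` with its graph norm. -/
abbrev DomA (H : ℝ) : Type := graphA H

/-- The underlying `L²` function `u` of an element of `D(A)`. -/
def DomA.fn {H : ℝ} (u : DomA H) : L2 ℂ := u.1.fst

/-- The `L²` function `A u` of an element `u` of `D(A)`. -/
def DomA.opA {H : ℝ} (u : DomA H) : L2 ℂ := u.1.snd

/-- `(u, ρ)`, with time derivatives `ut`, `ρt`, `ρtt`, is a global solution of the semilinear
Cauchy problem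
`i u_t + u_xx = -ρ u + a |u|² u + H² x² u`, `ρ_tt = α ρ_xx - b ρ + |u|²`,
`u(0) = u₀`, `ρ(0) = ρ₀`, `ρ_t(0) = ρ₁`, in the class
`u ∈ C([0,∞); D(A)) ∩ C¹([0,∞); L²)`,
`ρ ∈ C([0,∞); H³) ∩ C¹([0,∞); H²) ∩ C²([0,∞); H¹)`.
Values at negative times play no role. -/
structure IsGlobalSolution (α a b H : ℝ)
    (u₀ : DomA H) (ρ₀ : Sobolev ℝ 3) (ρ₁ : Sobolev ℝ 2)
    (u : ℝ → DomA H) (ut : ℝ → L2 ℂ)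
    (ρ : ℝ → Sobolev ℝ 3) (ρt : ℝ → Sobolev ℝ 2) (ρtt : ℝ → Sobolev ℝ 1) : Prop where
  continuousOn_u : ContinuousOn u (Ici 0)
  hasDeriv_u : ∀ t ∈ Ici (0 : ℝ), HasDerivWithinAt (fun s => (u s).fn) (ut t) (Ici 0) t
  continuousOn_ut : ContinuousOn ut (Ici 0)
  continuousOn_ρ : ContinuousOn ρ (Ici 0)
  hasDeriv_ρ : ∀ t ∈ Ici (0 : ℝ),
    HasDerivWithinAt (fun s => (ρ s).incl (show 2 ≤ 3 by norm_num)) (ρt t) (Ici 0) t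
  continuousOn_ρt : ContinuousOn ρt (Ici 0)
  hasDeriv_ρt : ∀ t ∈ Ici (0 : ℝ),
    HasDerivWithinAt (fun s => (ρt s).incl (show 1 ≤ 2 by norm_num)) (ρtt t) (Ici 0) t
  continuousOn_ρtt : ContinuousOn ρtt (Ici 0)
  schrodinger : ∀ t ∈ Ici (0 : ℝ), ∀ᵐ x : ℝ,
    Complex.I * ut t x + (u t).opA x =
      -(((ρ t).fn x : ℝ) : ℂ) * (u t).fn x
        + (a : ℂ) * ((‖(u t).fn x‖ ^ 2 : ℝ) : ℂ) * (u t).fn x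
  wave : ∀ t ∈ Ici (0 : ℝ), ∀ᵐ x : ℝ,
    (ρtt t).fn x = α * (ρ t).D 2 x - b * (ρ t).fn x + ‖(u t).fn x‖ ^ 2
  initial_u : u 0 = u₀
  initial_ρ : ρ 0 = ρ₀
  initial_ρt : ρt 0 = ρ₁

/-- The `L²` function `f` vanishes almost everywhere outside the set `S`. -/
def VanishesOff {E : Type} [NormedAddCommGroup E] (f : L2 E) (S : Set ℝ) : Prop :=
  ∀ᵐ x : ℝ, x ∉ S → f x = 0

end LiquidCrystal

end

open LiquidCrystal

/-!
The mass `‖u‖²` and the energy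
`‖u_x‖² + H² ‖x u‖² + (a/2) ‖|u|²‖² - ⟨ρ, |u|²⟩ + (‖ρ_t‖² + α ‖ρ_x‖² + b ‖ρ‖²) / 2`
are conserved (`IsGlobalSolution.norm_u_eq`, `IsGlobalSolution.energy_eq`). On the line
`‖|u|²‖₂² ≤ 4 ‖u‖³ ‖u_x‖`, so both nonlinear terms of the energy are absorbed by the quadratic ones,
whatever the sign of `a`, and `‖u_x‖`, `‖ρ_x‖`, `‖ρ_t‖` are bounded uniformly in time by a
constant depending only on the coefficients, on `θ` and on the norms of the data
(`norm_sq_le_of_energy_le`, `energy_le`; the support of `u₀` enters through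
`‖x u₀‖ ≤ θ ‖u₀‖`).

Now let `ψ` be a smooth weight which vanishes on `]-θ, θ[`, equals `1` for `|x| ≥ θ + δ` and has
slope at most `C`, where `C` is of order `1 / δ`. The localized mass `∫ ψ |u|²` vanishes
initially and changes only by a flux bounded by `2 C ‖u‖ ‖u_x‖`, so it is `O(C t)`. The localized
wave energy `∫ ψ (ρ_t² + α ρ_x² + b ρ²)` also vanishes initially; its derivative consists of a
flux of order `C` and of the source term `2 ∫ ψ ρ_t |u|²`, which is at most
`2 ‖ρ_t‖ ‖u‖_∞ (∫ ψ |u|²)^(1/2) = O((C t)^(1/2))`. Both quantities at time `t` therefore tend to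
zero with `C` (`IsGlobalSolution.weightedSq_add_waveEnergy_le`), and `C` is chosen first, `δ`
afterwards.

Two points need care. Since `u` is differentiable in time only as a curve in `L²`, the terms
`⟨A u, u⟩` and `|u|²` are differentiated by `hasDerivWithinAt_bilinear`, which uses the continuity
of `u` in `D(A)` and a symmetry of the expression, in the first case the symmetry of `A`. And
`u_xx = A u + H² x² u` is a priori only locally square integrable, so integration by parts is
proved for locally integrable weak derivatives, assuming only that the products which occur are
integrable (`IsLocalWeakDeriv.integral_mul_add_mul_eq_zero`); its proof passes to
absolutely continuous representatives.
-/

namespace LiquidCrystal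

open Filter Topology

/-! ### Locally absolutely continuous functions on the line -/

/-- `F` is a primitive of the locally integrable function `f`, that is, `F` is locally absolutely
continuous with `F' = f` almost everywhere. -/
structure IsPrimitive (F f : ℝ → ℝ) : Prop where
  locallyIntegrable : LocallyIntegrable f
  eq_add_integral : ∀ x, F x = F 0 + ∫ y in (0 : ℝ)..x, f y

theorem _root_.MeasureTheory.LocallyIntegrable.intervalIntegrable' {f : ℝ → ℝ}
    (hf : LocallyIntegrable f) (a b : ℝ) : IntervalIntegrable f volume a b :=
  intervalIntegrable_iff.mpr
    ((hf.integrableOn_isCompact isCompact_uIcc).mono_set uIoc_subset_uIcc)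

theorem IsPrimitive.absolutelyContinuousOnInterval {F f : ℝ → ℝ} (h : IsPrimitive F f)
    (a b : ℝ) : AbsolutelyContinuousOnInterval F a b := by
  have key : AbsolutelyContinuousOnInterval F (min 0 (min a b)) (max 0 (max a b)) := by
    have h1 := (h.locallyIntegrable.intervalIntegrable' (min 0 (min a b))
      (max 0 (max a b))).absolutelyContinuousOnInterval_intervalIntegral (c := 0)
      (mem_uIcc_of_le (by simp) (by simp))
    have h2 : AbsolutelyContinuousOnInterval (fun _ : ℝ => F 0) (min 0 (min a b))
      (max 0 (max a b)) := contDiff_const.contDiffOn.absolutelyContinuousOnInterval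
    have h3 := h2.add h1
    have e : F = (fun _ : ℝ => F 0) + fun x => ∫ y in (0 : ℝ)..x, f y :=
      funext h.eq_add_integral
    rw [e]
    simpa using h3
  refine key.mono (uIcc_subset_uIcc ?_ ?_) <;> exact mem_uIcc_of_le (by simp) (by simp)

theorem IsPrimitive.continuous {F f : ℝ → ℝ} (h : IsPrimitive F f) : Continuous F := by
  rw [continuous_iff_continuousAt]
  intro x
  refine (h.absolutelyContinuousOnInterval (x - 1) (x + 1)).continuousOn.continuousAt ?_
  rw [uIcc_of_le (by linarith)]
  exact Icc_mem_nhds (by linarith) (by linarith)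

theorem IsPrimitive.deriv_ae {F f : ℝ → ℝ} (h : IsPrimitive F f) : ∀ᵐ x, deriv F x = f x := by
  filter_upwards [LocallyIntegrable.ae_hasDerivAt_integral h.locallyIntegrable] with x hx
  have e : F = fun x => F 0 + ∫ y in (0 : ℝ)..x, f y := funext h.eq_add_integral
  have := (hx 0).const_add (F 0)
  rw [← e] at this
  exact this.deriv

theorem IsPrimitive.of_contDiff {F : ℝ → ℝ} (h : ContDiff ℝ ∞ F) : IsPrimitive F (deriv F) := by
  have h1 : Continuous (deriv F) := h.continuous_deriv (by simp)
  refine ⟨h1.locallyIntegrable, fun x => ?_⟩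
  rw [intervalIntegral.integral_deriv_eq_sub (fun y _ => (h.differentiable (by simp)) y)
    (h1.intervalIntegrable _ _)]
  ring

theorem IsPrimitive.integral_eq_sub {F f : ℝ → ℝ} (h : IsPrimitive F f) (a b : ℝ) :
    ∫ x in a..b, f x = F b - F a := by
  rw [h.eq_add_integral a, h.eq_add_integral b, ← intervalIntegral.integral_interval_sub_left
    (h.locallyIntegrable.intervalIntegrable' 0 b) (h.locallyIntegrable.intervalIntegrable' 0 a)]
  ring

/-- The product rule for locally absolutely continuous functions. -/
theorem IsPrimitive.mul {F f G g : ℝ → ℝ} (hF : IsPrimitive F f) (hG : IsPrimitive G g) :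
    IsPrimitive (fun x => F x * G x) (fun x => f x * G x + F x * g x) := by
  refine ⟨?_, fun x => ?_⟩
  · refine LocallyIntegrable.add ?_ ?_
    · exact (hF.locallyIntegrable.mul_continuous hG.continuous)
    · exact (hG.locallyIntegrable.continuous_mul hF.continuous)
  · have h := AbsolutelyContinuousOnInterval.integral_deriv_mul_eq_sub
      (hF.absolutelyContinuousOnInterval 0 x) (hG.absolutelyContinuousOnInterval 0 x)
    rw [intervalIntegral.integral_congr_ae (g := fun x => f x * G x + F x * g x)] at h
    · linarith
    · filter_upwards [hF.deriv_ae, hG.deriv_ae] with y h1 h2 _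
      rw [h1, h2]

/-- `f'` is the distributional derivative of `f`, both being locally integrable. -/
structure IsLocalWeakDeriv (f f' : ℝ → ℝ) : Prop where
  left : LocallyIntegrable f
  right : LocallyIntegrable f'
  integral_eq : ∀ φ, IsTest φ → ∫ x, deriv φ x * f x = - ∫ x, φ x * f' x

theorem IsTest.integrable_mul {φ f : ℝ → ℝ} (hφ : IsTest φ) (hf : LocallyIntegrable f) :
    Integrable fun x => φ x * f x := by
  simpa using hf.integrable_smul_left_of_hasCompactSupport hφ.continuous hφ.2

theorem IsTest.exists_bound {φ : ℝ → ℝ} (hφ : IsTest φ) :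
    ∃ n : ℝ, ∀ x, n ≤ |x| → φ x = 0 := by
  obtain ⟨n, hn⟩ := hφ.2.isCompact.isBounded.subset_ball 0
  refine ⟨n, fun x hx => ?_⟩
  by_contra h
  have h1 := hn (subset_tsupport _ (Function.mem_support.2 h))
  rw [mem_ball_zero_iff, Real.norm_eq_abs] at h1
  linarith

theorem integral_eq_intervalIntegral {f : ℝ → ℝ} {n : ℝ}
    (h : ∀ x, n ≤ |x| → f x = 0) : ∫ x, f x = ∫ x in (-n)..n, f x := by
  rw [intervalIntegral.integral_eq_integral_of_support_subset]
  intro x hx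
  have : |x| < n := not_le.1 fun h' => hx (h x h')
  exact ⟨(abs_lt.1 this).1, (abs_lt.1 this).2.le⟩

theorem IsPrimitive.integral_test {F f : ℝ → ℝ} (h : IsPrimitive F f) {φ : ℝ → ℝ}
    (hφ : IsTest φ) : ∫ x, deriv φ x * F x = - ∫ x, φ x * f x := by
  obtain ⟨n, h0⟩ := hφ.exists_bound
  obtain ⟨m, h1⟩ := hφ.deriv.exists_bound
  have k0 : ∀ x, max n m ≤ |x| → φ x = 0 := fun x hx => h0 x ((le_max_left _ _).trans hx)
  have k1 : ∀ x, max n m ≤ |x| → deriv φ x = 0 := fun x hx => h1 x ((le_max_right _ _).trans hx)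
  have key := ((IsPrimitive.of_contDiff hφ.1).mul h).integral_eq_sub (-(max n m)) (max n m)
  rw [k0 (max n m) (le_abs_self _), k0 (-(max n m)) (by rw [abs_neg]; exact le_abs_self _)] at key
  rw [← integral_eq_intervalIntegral (fun x hx => by rw [k0 x hx, k1 x hx]; ring),
    integral_add (hφ.deriv.integrable_mul h.continuous.locallyIntegrable)
      (hφ.integrable_mul h.locallyIntegrable)] at key
  linarith

theorem exists_isTest_integral_eq_one : ∃ φ : ℝ → ℝ, IsTest φ ∧ ∫ x, φ x = 1 := by
  let b : ContDiffBump (0 : ℝ) := default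
  exact ⟨b.normed volume, ⟨b.contDiff_normed, b.hasCompactSupport_normed⟩, b.integral_normed⟩

/-- A test function of integral zero is the derivative of a test function. -/
theorem exists_isTest_deriv_eq {φ : ℝ → ℝ} (hφ : IsTest φ) (h : ∫ x, φ x = 0) :
    ∃ Φ, IsTest Φ ∧ deriv Φ = φ := by
  obtain ⟨n, h0⟩ := hφ.exists_bound
  have hd : ∀ x, HasDerivAt (fun x => ∫ y in (-n)..x, φ y) (φ x) x := fun x =>
    intervalIntegral.integral_hasDerivAt_right (hφ.continuous.intervalIntegrable _ _)
      (hφ.continuous.stronglyMeasurableAtFilter _ _) hφ.continuous.continuousAt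
  have hd' : deriv (fun x => ∫ y in (-n)..x, φ y) = φ := funext fun x => (hd x).deriv
  have hz : ∀ a b : ℝ, (∀ x ∈ uIcc a b, n ≤ |x|) → ∫ y in a..b, φ y = 0 := fun a b hab => by
    rw [intervalIntegral.integral_congr (g := fun _ => 0) fun x hx => h0 x (hab x hx)]
    simp
  refine ⟨fun x => ∫ y in (-n)..x, φ y, ⟨?_, ?_⟩, hd'⟩
  · rw [contDiff_infty_iff_deriv, hd']
    exact ⟨fun x => (hd x).differentiableAt, hφ.1⟩
  · refine HasCompactSupport.intro (isCompact_Icc (a := -n) (b := n)) fun x hx => ?_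
    rcases lt_or_ge x (-n) with h1 | h1
    · refine hz _ _ fun y hy => ?_
      rw [uIcc_of_ge h1.le] at hy
      linarith [hy.2, neg_le_abs y]
    · have h2 : n < x := not_le.1 fun h3 => hx ⟨h1, h3⟩
      rw [← intervalIntegral.integral_add_adjacent_intervals (b := n)
        (hφ.continuous.intervalIntegrable _ _) (hφ.continuous.intervalIntegrable _ _),
        ← integral_eq_intervalIntegral h0, h, zero_add]
      refine hz _ _ fun y hy => ?_
      rw [uIcc_of_le h2.le] at hy
      exact hy.1.trans (le_abs_self y)

/-- The lemma of du Bois-Reymond. -/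
theorem ae_eq_const_of_integral_deriv_eq_zero {f : ℝ → ℝ} (hf : LocallyIntegrable f)
    (h : ∀ φ, IsTest φ → ∫ x, deriv φ x * f x = 0) : ∃ c, ∀ᵐ x, f x = c := by
  obtain ⟨φ₀, h₀, h₁⟩ := exists_isTest_integral_eq_one
  -- Testing against `φ₀` identifies the constant, since `∫ φ₀ = 1`.
  refine ⟨∫ x, φ₀ x * f x, ?_⟩
  set c := ∫ x, φ₀ x * f x
  have key := ae_eq_zero_of_integral_contDiff_smul_eq_zero
    (hf.sub (locallyIntegrable_const c)) fun φ h1 h2 => ?_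
  · filter_upwards [key] with x hx
    simpa [sub_eq_zero] using hx
  have hφ : IsTest φ := ⟨h1, h2⟩
  set m := ∫ x, φ x
  have hi : ∀ {φ}, IsTest φ → Integrable φ := fun h =>
    h.continuous.integrable_of_hasCompactSupport h.2
  have ht : IsTest fun x => φ x - m * φ₀ x :=
    ⟨h1.sub (contDiff_const.mul h₀.1), h2.sub h₀.2.mul_left⟩
  obtain ⟨Φ, hΦ, e⟩ := exists_isTest_deriv_eq ht (by
    rw [integral_sub (hi hφ) ((hi h₀).const_mul m), integral_const_mul, h₁, mul_one, sub_self])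
  have h3 := h Φ hΦ
  rw [e] at h3
  simp only [sub_mul, mul_assoc] at h3
  rw [integral_sub (hφ.integrable_mul hf) ((h₀.integrable_mul hf).const_mul m),
    integral_const_mul] at h3
  simp only [smul_eq_mul, Pi.sub_apply, mul_sub]
  rw [integral_sub (hφ.integrable_mul hf) ((hi hφ).mul_const c), integral_mul_const]
  exact h3

theorem IsLocalWeakDeriv.exists_isPrimitive {f f' : ℝ → ℝ} (h : IsLocalWeakDeriv f f') :
    ∃ F, IsPrimitive F f' ∧ f =ᵐ[volume] F := by
  have hp : IsPrimitive (fun x => ∫ y in (0 : ℝ)..x, f' y) f' := ⟨h.right, fun x => by simp⟩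
  obtain ⟨c, hc⟩ := ae_eq_const_of_integral_deriv_eq_zero
    (h.left.sub hp.continuous.locallyIntegrable) fun φ hφ => by
      simp only [Pi.sub_apply, mul_sub]
      rw [integral_sub (hφ.deriv.integrable_mul h.left)
        (hφ.deriv.integrable_mul hp.continuous.locallyIntegrable), h.integral_eq φ hφ,
        hp.integral_test hφ, sub_self]
  refine ⟨fun x => c + ∫ y in (0 : ℝ)..x, f' y, ⟨h.right, fun x => by simp⟩, ?_⟩
  filter_upwards [hc] with x hx
  rw [← hx, Pi.sub_apply, sub_add_cancel]

/-- If a locally absolutely continuous function is integrable together with its derivative, then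
it has a limit at `+∞`, which is zero by integrability. -/
theorem IsPrimitive.tendsto_atTop_zero {F f : ℝ → ℝ} (h : IsPrimitive F f) (hF : Integrable F)
    (hf : Integrable f) : Tendsto F atTop (𝓝 0) := by
  have e : Tendsto F atTop (𝓝 (F 0 + ∫ x in Ioi 0, f x)) := by
    refine Tendsto.congr (fun x => (h.eq_add_integral x).symm) (Tendsto.const_add _ ?_)
    exact intervalIntegral_tendsto_integral_Ioi 0 hf.integrableOn tendsto_id
  have z := IntegrableAtFilter.eq_zero_of_tendsto (hF.integrableAtFilter _) (fun s hs => by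
    obtain ⟨a, ha⟩ := mem_atTop_sets.1 hs
    exact top_unique ((Real.volume_Ici (a := a)).symm.le.trans (measure_mono ha))) e
  rwa [z] at e

/-- A locally absolutely continuous function which is integrable together with its derivative
tends to zero at infinity, hence its derivative has integral zero. -/
theorem IsPrimitive.integral_eq_zero {F f : ℝ → ℝ} (h : IsPrimitive F f) (hF : Integrable F)
    (hf : Integrable f) : ∫ x, f x = 0 := by
  have e1 : Tendsto F atTop (𝓝 (F 0 + ∫ x in Ioi 0, f x)) := by
    refine Tendsto.congr (fun x => (h.eq_add_integral x).symm) (Tendsto.const_add _ ?_)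
    exact intervalIntegral_tendsto_integral_Ioi 0 hf.integrableOn tendsto_id
  have z1 := tendsto_nhds_unique e1 (h.tendsto_atTop_zero hF hf)
  have e2 : Tendsto F atBot (𝓝 (F 0 - ∫ x in Iic 0, f x)) := by
    refine Tendsto.congr (fun x => ?_) (Tendsto.const_sub (F 0)
      (intervalIntegral_tendsto_integral_Iic 0 hf.integrableOn tendsto_id))
    rw [id, intervalIntegral.integral_symm, sub_neg_eq_add, ← h.eq_add_integral x]
  have z2 := IntegrableAtFilter.eq_zero_of_tendsto (hF.integrableAtFilter _) (fun s hs => by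
    obtain ⟨a, ha⟩ := mem_atBot_sets.1 hs
    exact top_unique ((Real.volume_Iic (a := a)).symm.le.trans (measure_mono ha))) e2
  rw [← intervalIntegral.integral_Iic_add_Ioi (b := 0) hf.integrableOn hf.integrableOn]
  linarith

/-- Integration by parts on the line, without boundary terms. -/
theorem IsLocalWeakDeriv.integral_mul_add_mul_eq_zero {f f' g g' : ℝ → ℝ}
    (hf : IsLocalWeakDeriv f f') (hg : IsLocalWeakDeriv g g')
    (h : Integrable fun x => f x * g x) (h₁ : Integrable fun x => f' x * g x)
    (h₂ : Integrable fun x => f x * g' x) :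
    ∫ x, (f' x * g x + f x * g' x) = 0 := by
  obtain ⟨F, hF, eF⟩ := hf.exists_isPrimitive
  obtain ⟨G, hG, eG⟩ := hg.exists_isPrimitive
  have e : (fun x => f' x * g x + f x * g' x) =ᵐ[volume] fun x => f' x * G x + F x * g' x := by
    filter_upwards [eF, eG] with x h1 h2
    rw [h1, h2]
  rw [integral_congr_ae e]
  refine (hF.mul hG).integral_eq_zero (h.congr ?_) ((h₁.add h₂).congr e)
  filter_upwards [eF, eG] with x h1 h2
  rw [h1, h2]

/-- The Sobolev inequality `‖f‖_∞² ≤ 2 ‖f‖₂ ‖f'‖₂` on the line, with the right-hand side in the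
form `2 ∫ |f f'|`. -/
theorem IsLocalWeakDeriv.sq_le_integral {f f' : ℝ → ℝ} (hf : IsLocalWeakDeriv f f')
    (h : Integrable fun x => f x * f x) (h' : Integrable fun x => f x * f' x) :
    ∀ᵐ x, f x ^ 2 ≤ 2 * ∫ y, |f y * f' y| := by
  obtain ⟨F, hF, eF⟩ := hf.exists_isPrimitive
  have i1 : Integrable fun x => F x * F x := h.congr (by
    filter_upwards [eF] with x h1; rw [h1])
  have i2 : Integrable fun x => F x * f' x := h'.congr (by
    filter_upwards [eF] with x h1; rw [h1])
  have i3 : Integrable fun x => f' x * F x + F x * f' x :=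
    (i2.add i2).congr (Eventually.of_forall fun x => by simp only [Pi.add_apply]; ring)
  have hp := hF.mul hF
  have e1 := hp.tendsto_atTop_zero i1 i3
  have key : ∀ x, F x ^ 2 ≤ 2 * ∫ y, |f y * f' y| := fun x => by
    have e2 : Tendsto (fun y => F x * F x - F y * F y) atTop (𝓝 (F x * F x - 0)) :=
      tendsto_const_nhds.sub e1
    rw [sub_zero] at e2
    rw [sq]
    refine le_of_tendsto e2 (Eventually.of_forall fun y => ?_)
    have e3 : ∫ y, |f y * f' y| = ∫ y, |F y * f' y| := integral_congr_ae (by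
      filter_upwards [eF] with z h1; rw [h1])
    have e4 : ∀ z, ‖f' z * F z + F z * f' z‖ = 2 * |F z * f' z| := fun z => by
      rw [mul_comm (f' z), ← two_mul, Real.norm_eq_abs, abs_mul, abs_two]
    rw [← hp.integral_eq_sub y x, e3, ← integral_const_mul]
    simp only [← e4]
    exact (le_abs_self _).trans (intervalIntegral.norm_integral_le_integral_norm_uIoc.trans
      (setIntegral_le_integral i3.norm (Eventually.of_forall fun _ => norm_nonneg _)))
  filter_upwards [eF] with x hx
  rw [hx]
  exact key x

/-! ### Weak derivatives and integration by parts -/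

theorem inner_eq_mul (x y : ℝ) : inner ℝ x y = x * y := by simp [mul_comm]

theorem Lp.locallyIntegrable' {E : Type} [NormedAddCommGroup E] (f : L2 E) :
    LocallyIntegrable f := (Lp.memLp f).locallyIntegrable (by norm_num)

theorem IsWeakDeriv.isLocalWeakDeriv {f g : L2 ℝ} (h : IsWeakDeriv f g) :
    IsLocalWeakDeriv f g :=
  ⟨Lp.locallyIntegrable' f, Lp.locallyIntegrable' g, fun φ hφ => by simpa using h φ hφ⟩

/-- Multiplication of a weakly differentiable function by a smooth one. -/
theorem IsLocalWeakDeriv.contDiff_mul {f f' ψ : ℝ → ℝ} (h : IsLocalWeakDeriv f f')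
    (hψ : ContDiff ℝ ∞ ψ) :
    IsLocalWeakDeriv (fun x => ψ x * f x) (fun x => deriv ψ x * f x + ψ x * f' x) := by
  have hc : Continuous (deriv ψ) := hψ.continuous_deriv (by simp)
  have i1 : LocallyIntegrable fun x => ψ x * f x := h.left.continuous_mul hψ.continuous
  have i2 : LocallyIntegrable fun x => deriv ψ x * f x := h.left.continuous_mul hc
  have i3 : LocallyIntegrable fun x => ψ x * f' x := h.right.continuous_mul hψ.continuous
  refine ⟨i1, i2.add i3, fun φ hφ => ?_⟩
  have ht : IsTest fun x => ψ x * φ x := ⟨hψ.mul hφ.1, hφ.2.mul_left⟩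
  have e : ∀ x, deriv (fun x => ψ x * φ x) x = deriv ψ x * φ x + ψ x * deriv φ x := fun x =>
    deriv_fun_mul (hψ.differentiable (by simp) x) (hφ.1.differentiable (by simp) x)
  have key := h.integral_eq _ ht
  simp only [e] at key
  have a1 := hφ.integrable_mul i2
  have a2 := hφ.deriv.integrable_mul i1
  have a3 := hφ.integrable_mul i3
  rw [integral_congr_ae (g := fun x => φ x * (deriv ψ x * f x) + deriv φ x * (ψ x * f x))
    (Eventually.of_forall fun x => by ring), integral_add a1 a2,
    integral_congr_ae (f := fun x => ψ x * φ x * f' x) (g := fun x => φ x * (ψ x * f' x))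
    (Eventually.of_forall fun x => by ring)] at key
  simp only [mul_add]
  rw [integral_add a1 a3]
  linarith

/-- The weak derivative of a complex function on the line, by real and imaginary parts. -/
structure IsLocalWeakDerivC (f f' : ℝ → ℂ) : Prop where
  re : IsLocalWeakDeriv (fun x => (f x).re) (fun x => (f' x).re)
  im : IsLocalWeakDeriv (fun x => (f x).im) (fun x => (f' x).im)

theorem _root_.MeasureTheory.LocallyIntegrable.re {f : ℝ → ℂ} (h : LocallyIntegrable f) :
    LocallyIntegrable fun x => (f x).re := by
  intro x
  obtain ⟨s, hs, hi⟩ := h x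
  exact ⟨s, hs, Integrable.re hi⟩

theorem _root_.MeasureTheory.LocallyIntegrable.im {f : ℝ → ℂ} (h : LocallyIntegrable f) :
    LocallyIntegrable fun x => (f x).im := by
  intro x
  obtain ⟨s, hs, hi⟩ := h x
  exact ⟨s, hs, Integrable.im hi⟩

theorem IsTest.integrable_smul {φ : ℝ → ℝ} {f : ℝ → ℂ} (hφ : IsTest φ)
    (hf : LocallyIntegrable f) : Integrable fun x => φ x • f x :=
  hf.integrable_smul_left_of_hasCompactSupport hφ.continuous hφ.2

theorem integral_smul_re {φ : ℝ → ℝ} {f : ℝ → ℂ} (h : Integrable fun x => φ x • f x) :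
    ∫ x, φ x * (f x).re = (∫ x, φ x • f x).re := by
  have := Complex.reCLM.integral_comp_comm h
  simpa using this

theorem integral_smul_im {φ : ℝ → ℝ} {f : ℝ → ℂ} (h : Integrable fun x => φ x • f x) :
    ∫ x, φ x * (f x).im = (∫ x, φ x • f x).im := by
  have := Complex.imCLM.integral_comp_comm h
  simpa using this

theorem IsLocalWeakDerivC.of_integral {f f' : ℝ → ℂ} (hf : LocallyIntegrable f)
    (hf' : LocallyIntegrable f')
    (h : ∀ φ, IsTest φ → ∫ x, deriv φ x • f x = - ∫ x, φ x • f' x) : IsLocalWeakDerivC f f' :=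
  ⟨⟨hf.re, hf'.re, fun φ hφ => by
    rw [integral_smul_re (hφ.deriv.integrable_smul hf), h φ hφ,
      integral_smul_re (hφ.integrable_smul hf'), Complex.neg_re]⟩,
   ⟨hf.im, hf'.im, fun φ hφ => by
    rw [integral_smul_im (hφ.deriv.integrable_smul hf), h φ hφ,
      integral_smul_im (hφ.integrable_smul hf'), Complex.neg_im]⟩⟩

theorem IsWeakDeriv.isLocalWeakDerivC {f g : L2 ℂ} (h : IsWeakDeriv f g) :
    IsLocalWeakDerivC f g :=
  .of_integral (Lp.locallyIntegrable' f) (Lp.locallyIntegrable' g) h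

theorem IsLocalWeakDeriv.neg {f f' : ℝ → ℝ} (h : IsLocalWeakDeriv f f') :
    IsLocalWeakDeriv (fun x => -f x) (fun x => -f' x) :=
  ⟨h.left.neg, h.right.neg, fun φ hφ => by
    simp only [mul_neg, integral_neg, h.integral_eq φ hφ]⟩

theorem IsLocalWeakDerivC.I_mul {f f' : ℝ → ℂ} (h : IsLocalWeakDerivC f f') :
    IsLocalWeakDerivC (fun x => Complex.I * f x) (fun x => Complex.I * f' x) :=
  ⟨by simpa using h.im.neg, by simpa using h.re⟩

theorem IsLocalWeakDerivC.contDiff_mul {f f' : ℝ → ℂ} {ψ : ℝ → ℝ} (h : IsLocalWeakDerivC f f')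
    (hψ : ContDiff ℝ ∞ ψ) :
    IsLocalWeakDerivC (fun x => ψ x * f x) (fun x => deriv ψ x * f x + ψ x * f' x) :=
  ⟨by simpa using h.re.contDiff_mul hψ, by simpa using h.im.contDiff_mul hψ⟩

/-- Weak derivatives are unique. -/
theorem IsWeakDeriv.unique {E : Type} [NormedAddCommGroup E] [NormedSpace ℝ E] [CompleteSpace E]
    {f g g' : L2 E} (h : IsWeakDeriv f g) (h' : IsWeakDeriv f g') : g = g' := by
  refine Lp.ext (ae_eq_of_integral_contDiff_smul_eq (Lp.locallyIntegrable' g)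
    (Lp.locallyIntegrable' g') fun φ h1 h2 => ?_)
  rw [← neg_inj, ← h φ ⟨h1, h2⟩, ← h' φ ⟨h1, h2⟩]

/-- The weak derivative of a function vanishing off the open set `S` vanishes wherever a smooth
function vanishing on `S` does not. -/
theorem IsWeakDeriv.ae_mul_eq_zero {f g : L2 ℝ} (h : IsWeakDeriv f g) {S : Set ℝ} (hS : IsOpen S)
    (hf : VanishesOff f S) {ψ : ℝ → ℝ} (hψ : ContDiff ℝ ∞ ψ) (h0 : ∀ x ∈ S, ψ x = 0) :
    ∀ᵐ x, ψ x * g x = 0 := by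
  refine ae_eq_zero_of_integral_contDiff_smul_eq_zero
    (h.isLocalWeakDeriv.right.continuous_mul hψ.continuous) fun φ h1 h2 => ?_
  have ht : IsTest fun x => ψ x * φ x := ⟨hψ.mul h1, h2.mul_left⟩
  have key := h _ ht
  have e : ∫ x, deriv (fun x => ψ x * φ x) x • f x = 0 := by
    refine integral_eq_zero_of_ae ?_
    filter_upwards [hf] with x hx
    by_cases hxS : x ∈ S
    · have : (fun x => ψ x * φ x) =ᶠ[𝓝 x] fun _ => 0 := by
        filter_upwards [hS.mem_nhds hxS] with y hy
        rw [h0 y hy, zero_mul]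
      simp [this.deriv_eq]
    · simp [hx hxS]
  rw [e, eq_comm, neg_eq_zero] at key
  rw [← key]
  refine integral_congr_ae (Eventually.of_forall fun x => ?_)
  simp only [smul_eq_mul]
  ring

section Multiplication

variable {E : Type} [NormedAddCommGroup E] [InnerProductSpace ℝ E]

/-- Multiplication by an essentially bounded function, as an operator on `L²`. -/
noncomputable def mulL2 (E : Type) [NormedAddCommGroup E] [InnerProductSpace ℝ E] {m : ℝ → ℝ}
    (hm : MemLp m ∞) : L2 E →L[ℝ] L2 E :=
  (ContinuousLinearMap.lsmul ℝ ℝ).holderL volume ∞ 2 2 (hm.toLp m)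

theorem coeFn_mulL2 {m : ℝ → ℝ} (hm : MemLp m ∞) (f : L2 E) :
    mulL2 E hm f =ᵐ[volume] fun x => m x • f x := by
  filter_upwards [(ContinuousLinearMap.lsmul ℝ ℝ).coeFn_holder (r := 2) (hm.toLp m) f,
    hm.coeFn_toLp] with x h1 h2
  refine Eq.trans h1 ?_
  rw [h2]
  rfl

theorem inner_mulL2 {m : ℝ → ℝ} (hm : MemLp m ∞) (f g : L2 E) :
    inner ℝ (mulL2 E hm f) g = ∫ x, m x * inner ℝ (f x) (g x) := by
  rw [L2.inner_def]
  refine integral_congr_ae ?_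
  filter_upwards [coeFn_mulL2 hm f] with x hx
  rw [hx, real_inner_smul_left]

theorem integrable_mul_inner {m : ℝ → ℝ} (hm : MemLp m ∞) (f g : L2 E) :
    Integrable fun x => m x * inner ℝ (f x) (g x) := by
  refine (L2.integrable_inner (𝕜 := ℝ) (mulL2 E hm f) g).congr ?_
  filter_upwards [coeFn_mulL2 hm f] with x hx
  rw [hx, real_inner_smul_left]

theorem norm_mulL2_le {m : ℝ → ℝ} (hm : MemLp m ∞) {C : ℝ} (hC : ∀ x, |m x| ≤ C) (f : L2 E) :
    ‖mulL2 E hm f‖ ≤ C * ‖f‖ := by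
  refine Lp.norm_le_mul_norm_of_ae_le_mul ?_
  filter_upwards [coeFn_mulL2 hm f] with x hx
  rw [hx, norm_smul]
  exact mul_le_mul_of_nonneg_right (hC x) (norm_nonneg _)

theorem abs_integral_mul_inner_le {m : ℝ → ℝ} (hm : MemLp m ∞) {C : ℝ} (hC : ∀ x, |m x| ≤ C)
    (f g : L2 E) : |∫ x, m x * inner ℝ (f x) (g x)| ≤ C * ‖f‖ * ‖g‖ := by
  rw [← inner_mulL2 hm]
  exact (abs_real_inner_le_norm _ _).trans
    (mul_le_mul_of_nonneg_right (norm_mulL2_le hm hC f) (norm_nonneg _))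

/-- The weighted square norm `∫ m |w|²` is differentiable along a differentiable curve in `L²`. -/
theorem hasDerivWithinAt_integral_mul_inner {m : ℝ → ℝ} (hm : MemLp m ∞) {w : ℝ → L2 E}
    {w' : L2 E} {S : Set ℝ} {t : ℝ} (h : HasDerivWithinAt w w' S t) :
    HasDerivWithinAt (fun s => ∫ x, m x * inner ℝ (w s x) (w s x))
      (2 * ∫ x, m x * inner ℝ (w t x) (w' x)) S t := by
  have h1 := ((mulL2 E hm).hasFDerivAt.comp_hasDerivWithinAt t h).inner ℝ h
  simp only [Function.comp_apply] at h1
  simp only [← inner_mulL2 hm]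
  have e : inner ℝ (mulL2 E hm w') (w t) = inner ℝ (mulL2 E hm (w t)) w' := by
    rw [inner_mulL2, inner_mulL2]
    simp only [real_inner_comm]
  rw [e, ← two_mul] at h1
  exact h1

end Multiplication

/-- Integration by parts in `H¹(ℝ)`, with a bounded smooth weight. -/
theorem IsWeakDeriv.integral_mul_eq {f f' g g' : L2 ℝ} (hf : IsWeakDeriv f f')
    (hg : IsWeakDeriv g g') {ψ : ℝ → ℝ} (hψ : ContDiff ℝ ∞ ψ) (h0 : MemLp ψ ∞)
    (h1 : MemLp (deriv ψ) ∞) :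
    ∫ x, ψ x * (f x * g' x) = - (∫ x, ψ x * (f' x * g x)) - ∫ x, deriv ψ x * (f x * g x) := by
  have i1 := integrable_mul_inner h0 f' g
  have i2 := integrable_mul_inner h1 f g
  have i3 := integrable_mul_inner h0 f g'
  have i4 := integrable_mul_inner h0 f g
  simp only [inner_eq_mul] at i1 i2 i3 i4
  have i5 : Integrable fun x => deriv ψ x * (f x * g x) + ψ x * (f x * g' x) := i2.add i3
  have key := hf.isLocalWeakDeriv.integral_mul_add_mul_eq_zero
    (hg.isLocalWeakDeriv.contDiff_mul hψ)
    (i4.congr (Eventually.of_forall fun x => by ring))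
    (i1.congr (Eventually.of_forall fun x => by ring))
    ((i2.add i3).congr (Eventually.of_forall fun x => by simp only [Pi.add_apply]; ring))
  rw [integral_congr_ae (g := fun x => ψ x * (f' x * g x) +
      (deriv ψ x * (f x * g x) + ψ x * (f x * g' x)))
    (Eventually.of_forall fun x => by ring), integral_add i1 i5, integral_add i2 i3] at key
  linarith

theorem integral_norm_mul_norm_le {f g : ℝ → ℂ} (hf : MemLp f 2) (hg : MemLp g 2) :
    ∫ x, ‖f x‖ * ‖g x‖ ≤ ‖hf.toLp f‖ * ‖hg.toLp g‖ := by
  have h := real_inner_le_norm (hf.norm.toLp fun x => ‖f x‖) (hg.norm.toLp fun x => ‖g x‖)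
  rw [L2.inner_def] at h
  simp only [Lp.norm_toLp, eLpNorm_norm] at h ⊢
  refine le_trans (le_of_eq (integral_congr_ae ?_)) h
  filter_upwards [hf.norm.coeFn_toLp, hg.norm.coeFn_toLp] with x h1 h2
  rw [h1, h2, inner_eq_mul]

/-- The Sobolev embedding `H¹(ℝ) ⊆ L^∞(ℝ)` in its multiplicative form. The constant is not sharp,
as real and imaginary parts are estimated separately. -/
theorem IsWeakDeriv.norm_sq_le {u v : L2 ℂ} (h : IsWeakDeriv u v) :
    ∀ᵐ x, ‖u x‖ ^ 2 ≤ 4 * ‖u‖ * ‖v‖ := by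
  have hu := Lp.memLp u
  have hv := Lp.memLp v
  have hb : Integrable fun x => ‖u x‖ * ‖v x‖ := hu.norm.integrable_mul hv.norm
  have hle := integral_norm_mul_norm_le hu hv
  rw [Lp.toLp_coeFn, Lp.toLp_coeFn] at hle
  have k1 : ∫ x, |(u x).re * (v x).re| ≤ ∫ x, ‖u x‖ * ‖v x‖ := by
    refine integral_mono (hu.re.integrable_mul hv.re).abs hb fun x => ?_
    rw [abs_mul]
    exact mul_le_mul (Complex.abs_re_le_norm _) (Complex.abs_re_le_norm _) (abs_nonneg _)
      (norm_nonneg _)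
  have k2 : ∫ x, |(u x).im * (v x).im| ≤ ∫ x, ‖u x‖ * ‖v x‖ := by
    refine integral_mono (hu.im.integrable_mul hv.im).abs hb fun x => ?_
    rw [abs_mul]
    exact mul_le_mul (Complex.abs_im_le_norm _) (Complex.abs_im_le_norm _) (abs_nonneg _)
      (norm_nonneg _)
  filter_upwards [h.isLocalWeakDerivC.re.sq_le_integral (hu.re.integrable_mul hu.re)
    (hu.re.integrable_mul hv.re), h.isLocalWeakDerivC.im.sq_le_integral
    (hu.im.integrable_mul hu.im) (hu.im.integrable_mul hv.im)] with x h1 h2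
  rw [Complex.sq_norm, Complex.normSq_apply]
  nlinarith

/-! ### The operator `A` and its domain -/

section Domain

variable {H : ℝ}

/-- The weak derivative `u_x` of an element of `D(A)`. -/
noncomputable def DomA.dx (u : DomA H) : L2 ℂ := u.2.1.1.choose

theorem DomA.isWeakDeriv_dx (u : DomA H) : IsWeakDeriv u.fn u.dx := u.2.1.1.choose_spec

theorem DomA.memLp_mul (u : DomA H) : MemLp (fun x : ℝ => (x : ℂ) * u.fn x) 2 := u.2.1.2

theorem DomA.isHermite (u : DomA H) : IsHermite H u.fn u.opA := u.2.2

/-- `u_xx = A u + H² x² u`; the right-hand side is only locally square integrable a priori. -/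
theorem DomA.isLocalWeakDerivC_dx (u : DomA H) :
    IsLocalWeakDerivC u.dx fun x => u.opA x + ((H ^ 2 * x ^ 2 : ℝ) : ℂ) * u.fn x := by
  have hu := Lp.locallyIntegrable' u.fn
  have hw := Lp.locallyIntegrable' u.opA
  have hc : Continuous fun x : ℝ => H ^ 2 * x ^ 2 := by fun_prop
  have hq : LocallyIntegrable fun x : ℝ => ((H ^ 2 * x ^ 2 : ℝ) : ℂ) * u.fn x :=
    hu.continuous_mul (by fun_prop : Continuous fun x : ℝ => ((H ^ 2 * x ^ 2 : ℝ) : ℂ))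
  refine .of_integral (Lp.locallyIntegrable' u.dx) (hw.add hq) fun φ hφ => ?_
  have h1 := u.isWeakDeriv_dx _ hφ.deriv
  have h2 := u.isHermite φ hφ
  have i1 := hφ.deriv.deriv.integrable_smul hu
  have i2 := hφ.integrable_smul hw
  have i3 := hφ.integrable_smul hq
  have e : ∀ x : ℝ, (deriv (deriv φ) x - H ^ 2 * x ^ 2 * φ x) • u.fn x =
      deriv (deriv φ) x • u.fn x - φ x • (((H ^ 2 * x ^ 2 : ℝ) : ℂ) * u.fn x) := fun x => by
    simp only [Complex.real_smul]
    push_cast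
    ring
  simp only [e] at h2
  rw [integral_sub i1 i3, h1] at h2
  simp only [smul_add]
  rw [integral_add i2 i3, ← h2]
  ring

theorem inner_eq_re_add_im (z w : ℂ) : inner ℝ z w = z.re * w.re + z.im * w.im := by
  simp [Complex.inner, Complex.mul_re, mul_comm]

/-- The quadratic form of `-A`: `⟨v, A u⟩ = -⟨v_x, u_x⟩ - H² ⟨x v, x u⟩` for `v` in the form
domain `X_A`. -/
theorem DomA.integral_inner_opA (u : DomA H) {v v' : ℝ → ℂ} (hv : IsLocalWeakDerivC v v')
    (h0 : MemLp v 2) (h1 : MemLp v' 2) (h2 : MemLp (fun x : ℝ => (x : ℂ) * v x) 2) :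
    ∫ x, inner ℝ (v x) (u.opA x) = -(∫ x, inner ℝ (v' x) (u.dx x)) -
      H ^ 2 * ∫ x : ℝ, inner ℝ (x * v x) (x * u.fn x) := by
  have hd := Lp.memLp u.dx
  have ha := Lp.memLp u.opA
  have hx := u.memLp_mul
  have r1 : Integrable fun x => (u.dx x).re * (v x).re := hd.re.integrable_mul h0.re
  have r2 : Integrable fun x => (u.dx x).re * (v' x).re := hd.re.integrable_mul h1.re
  have r3 : Integrable fun x => (u.opA x).re * (v x).re := ha.re.integrable_mul h0.re
  have r4 : Integrable fun x : ℝ => ((x : ℂ) * u.fn x).re * ((x : ℂ) * v x).re :=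
    hx.re.integrable_mul h2.re
  have s1 : Integrable fun x => (u.dx x).im * (v x).im := hd.im.integrable_mul h0.im
  have s2 : Integrable fun x => (u.dx x).im * (v' x).im := hd.im.integrable_mul h1.im
  have s3 : Integrable fun x => (u.opA x).im * (v x).im := ha.im.integrable_mul h0.im
  have s4 : Integrable fun x : ℝ => ((x : ℂ) * u.fn x).im * ((x : ℂ) * v x).im :=
    hx.im.integrable_mul h2.im
  have r5 : Integrable fun x : ℝ =>
      (u.opA x + ((H ^ 2 * x ^ 2 : ℝ) : ℂ) * u.fn x).re * (v x).re := by
    refine (r3.add (r4.const_mul (H ^ 2))).congr (Eventually.of_forall fun x => ?_)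
    simp only [Pi.add_apply, Complex.add_re, Complex.re_ofReal_mul]
    ring
  have s5 : Integrable fun x : ℝ =>
      (u.opA x + ((H ^ 2 * x ^ 2 : ℝ) : ℂ) * u.fn x).im * (v x).im := by
    refine (s3.add (s4.const_mul (H ^ 2))).congr (Eventually.of_forall fun x => ?_)
    simp only [Pi.add_apply, Complex.add_im, Complex.im_ofReal_mul]
    ring
  have kr := u.isLocalWeakDerivC_dx.re.integral_mul_add_mul_eq_zero hv.re r1 r5 r2
  have ki := u.isLocalWeakDerivC_dx.im.integral_mul_add_mul_eq_zero hv.im s1 s5 s2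
  have i1 : Integrable fun x => inner ℝ (v x) (u.opA x) :=
    (r3.add s3).congr (Eventually.of_forall fun x => by
      simp only [Pi.add_apply, inner_eq_re_add_im]; ring)
  have i2 : Integrable fun x => inner ℝ (v' x) (u.dx x) :=
    (r2.add s2).congr (Eventually.of_forall fun x => by
      simp only [Pi.add_apply, inner_eq_re_add_im]; ring)
  have i3 : Integrable fun x : ℝ => inner ℝ ((x : ℂ) * v x) (x * u.fn x) :=
    (r4.add s4).congr (Eventually.of_forall fun x => by
      simp only [Pi.add_apply, inner_eq_re_add_im]; ring)
  have i4 : Integrable fun x : ℝ => inner ℝ (v x) (u.opA x) + inner ℝ (v' x) (u.dx x) :=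
    i1.add i2
  have e : ∫ x : ℝ, (inner ℝ (v x) (u.opA x) + inner ℝ (v' x) (u.dx x) +
      H ^ 2 * inner ℝ ((x : ℂ) * v x) (x * u.fn x)) = 0 := by
    have := integral_add (r5.add r2) (s5.add s2)
    simp only [Pi.add_apply] at this
    rw [kr, ki, add_zero] at this
    rw [← this]
    refine integral_congr_ae (Eventually.of_forall fun x => ?_)
    simp only [inner_eq_re_add_im, Complex.add_re, Complex.add_im, Complex.re_ofReal_mul,
      Complex.im_ofReal_mul]
    ring
  rw [integral_add i4 (i3.const_mul _), integral_add i1 i2, integral_const_mul] at e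
  linarith

/-- `A` is symmetric. -/
theorem DomA.inner_opA_comm (u v : DomA H) : inner ℝ v.fn u.opA = inner ℝ u.fn v.opA := by
  rw [L2.inner_def, L2.inner_def, u.integral_inner_opA v.isWeakDeriv_dx.isLocalWeakDerivC
    (Lp.memLp _) (Lp.memLp _) v.memLp_mul, v.integral_inner_opA u.isWeakDeriv_dx.isLocalWeakDerivC
    (Lp.memLp _) (Lp.memLp _) u.memLp_mul]
  simp only [real_inner_comm]

/-- The linear part of the Schrödinger energy. -/
theorem DomA.neg_inner_opA_self (u : DomA H) : -inner ℝ u.fn u.opA =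
    ‖u.dx‖ ^ 2 + H ^ 2 * ∫ x : ℝ, x ^ 2 * ‖u.fn x‖ ^ 2 := by
  have e : ∀ x : ℝ, inner ℝ ((x : ℂ) * u.fn x) (x * u.fn x) = x ^ 2 * ‖u.fn x‖ ^ 2 := fun x => by
    rw [real_inner_self_eq_norm_sq, norm_mul, mul_pow, Complex.norm_real, Real.norm_eq_abs, sq_abs]
  rw [L2.inner_def, u.integral_inner_opA u.isWeakDeriv_dx.isLocalWeakDerivC
    (Lp.memLp _) (Lp.memLp _) u.memLp_mul, ← L2.inner_def, real_inner_self_eq_norm_sq]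
  simp only [e]
  ring

theorem DomA.norm_dx_sq_le (u : DomA H) : ‖u.dx‖ ^ 2 ≤ -inner ℝ u.fn u.opA := by
  rw [u.neg_inner_opA_self]
  have : 0 ≤ ∫ x : ℝ, x ^ 2 * ‖u.fn x‖ ^ 2 := integral_nonneg fun x => by positivity
  nlinarith [sq_nonneg H]

theorem DomA.norm_sq_eq (u : DomA H) : ‖u‖ ^ 2 = ‖u.fn‖ ^ 2 + ‖u.opA‖ ^ 2 :=
  WithLp.prod_norm_sq_eq_of_L2 u.1

theorem DomA.norm_fn_le (u : DomA H) : ‖u.fn‖ ≤ ‖u‖ :=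
  le_of_sq_le_sq (by nlinarith [u.norm_sq_eq, sq_nonneg ‖u.opA‖]) (norm_nonneg _)

theorem DomA.norm_opA_le (u : DomA H) : ‖u.opA‖ ≤ ‖u‖ :=
  le_of_sq_le_sq (by nlinarith [u.norm_sq_eq, sq_nonneg ‖u.fn‖]) (norm_nonneg _)

theorem DomA.norm_dx_le (u : DomA H) : ‖u.dx‖ ≤ ‖u‖ := by
  refine le_of_sq_le_sq (u.norm_dx_sq_le.trans ?_) (norm_nonneg _)
  refine (neg_le_abs _).trans ((abs_real_inner_le_norm _ _).trans ?_)
  rw [sq]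
  exact mul_le_mul u.norm_fn_le u.norm_opA_le (norm_nonneg _) (norm_nonneg _)

/-- `D(A) ⊆ L^∞`. -/
theorem DomA.ae_norm_le (u : DomA H) : ∀ᵐ x, ‖u.fn x‖ ≤ 2 * ‖u‖ := by
  filter_upwards [u.isWeakDeriv_dx.norm_sq_le] with x hx
  refine le_of_sq_le_sq (hx.trans ?_) (by positivity)
  nlinarith [mul_le_mul u.norm_fn_le u.norm_dx_le (norm_nonneg _) (norm_nonneg _)]

theorem DomA.memLp_top (u : DomA H) : MemLp u.fn ∞ :=
  memLp_top_of_bound (Lp.aestronglyMeasurable _) _ u.ae_norm_le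

/-- The map `u ↦ u`, continuous from `D(A)` to `L²`. -/
noncomputable def DomA.fnL (H : ℝ) : DomA H →L[ℝ] L2 ℂ :=
  LinearMap.mkContinuous ⟨⟨DomA.fn, fun _ _ => rfl⟩, fun _ _ => rfl⟩ 1 fun u => by
    rw [one_mul]; exact u.norm_fn_le

/-- The map `u ↦ A u`, continuous from `D(A)` to `L²`. -/
noncomputable def DomA.opAL (H : ℝ) : DomA H →L[ℝ] L2 ℂ :=
  LinearMap.mkContinuous ⟨⟨DomA.opA, fun _ _ => rfl⟩, fun _ _ => rfl⟩ 1 fun u => by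
    rw [one_mul]; exact u.norm_opA_le

/-- The embedding of `D(A)` into `L^∞`. -/
noncomputable def DomA.toLinf (H : ℝ) : DomA H →L[ℝ] Lp ℂ ∞ (volume : Measure ℝ) :=
  LinearMap.mkContinuous ⟨⟨fun u => u.memLp_top.toLp u.fn, fun u v => by
      rw [← MemLp.toLp_add]
      exact MemLp.toLp_congr _ _ (Lp.coeFn_add u.fn v.fn)⟩, fun c u => by
      simp only [RingHom.id_apply]
      rw [← MemLp.toLp_const_smul]
      exact MemLp.toLp_congr _ _ (Lp.coeFn_smul c u.fn)⟩ 2 fun u => by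
    refine (Lp.norm_toLp _ u.memLp_top).trans_le (ENNReal.toReal_le_of_le_ofReal
      (mul_nonneg zero_le_two (norm_nonneg u)) ?_)
    rw [eLpNorm_exponent_top]
    exact eLpNormEssSup_le_of_ae_bound u.ae_norm_le

theorem DomA.coeFn_toLinf (u : DomA H) : DomA.toLinf H u =ᵐ[volume] u.fn :=
  u.memLp_top.coeFn_toLp

/-- The bilinear map `(v, w) ↦ Re (v̄ w)`, continuous from `D(A) × L²` to `L²`. -/
noncomputable def DomA.innerL (H : ℝ) : DomA H →L[ℝ] L2 ℂ →L[ℝ] L2 ℝ :=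
  ((innerSL ℝ : ℂ →L[ℝ] ℂ →L[ℝ] ℝ).holderL volume ∞ 2 2).comp (DomA.toLinf H)

theorem DomA.coeFn_innerL (v : DomA H) (w : L2 ℂ) :
    DomA.innerL H v w =ᵐ[volume] fun x => inner ℝ (v.fn x) (w x) := by
  filter_upwards [(innerSL ℝ : ℂ →L[ℝ] ℂ →L[ℝ] ℝ).coeFn_holder (r := 2) (DomA.toLinf H v) w,
    v.coeFn_toLinf] with x h1 h2
  refine Eq.trans h1 ?_
  rw [h2, innerSL_apply_apply]

/-- The bilinear form `(v, w) ↦ ⟨A v, w⟩`, continuous on `D(A) × L²`. -/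
noncomputable def DomA.formL (H : ℝ) : DomA H →L[ℝ] L2 ℂ →L[ℝ] ℝ :=
  (innerSL ℝ : L2 ℂ →L[ℝ] L2 ℂ →L[ℝ] ℝ).comp (DomA.opAL H)

/-- The mass flux through a weight `ψ`: only the derivative of `ψ` contributes. -/
theorem DomA.abs_integral_mul_inner_I_opA_le (u : DomA H) {ψ : ℝ → ℝ} (hψ : ContDiff ℝ ∞ ψ)
    {B C : ℝ} (hB : ∀ x, |ψ x| ≤ B) (hC : ∀ x, |deriv ψ x| ≤ C) :
    |∫ x, ψ x * inner ℝ (u.fn x) (Complex.I * u.opA x)| ≤ C * ‖u.fn‖ * ‖u.dx‖ := by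
  have hc : Continuous (deriv ψ) := hψ.continuous_deriv (by simp)
  have m0 : MemLp (fun x => (ψ x : ℂ)) ∞ := memLp_top_of_bound
    (Complex.continuous_ofReal.comp hψ.continuous).aestronglyMeasurable B
    (Eventually.of_forall fun x => by simpa using hB x)
  have m1 : MemLp (fun x => ((deriv ψ x : ℝ) : ℂ)) ∞ := memLp_top_of_bound
    (Complex.continuous_ofReal.comp hc).aestronglyMeasurable C
    (Eventually.of_forall fun x => by simpa using hC x)
  have m1' : MemLp (deriv ψ) ∞ := memLp_top_of_bound hc.aestronglyMeasurable C
    (Eventually.of_forall hC)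
  have p0 : MemLp (fun x => (ψ x : ℂ) * u.fn x) 2 := (Lp.memLp u.fn).mul m0
  have p1 : MemLp (fun x => ((deriv ψ x : ℝ) : ℂ) * u.fn x) 2 := (Lp.memLp u.fn).mul m1
  have p2 : MemLp (fun x => (ψ x : ℂ) * u.dx x) 2 := (Lp.memLp u.dx).mul m0
  have p3 : MemLp (fun x : ℝ => (ψ x : ℂ) * (x * u.fn x)) 2 := u.memLp_mul.mul m0
  have key := u.integral_inner_opA (u.isWeakDeriv_dx.isLocalWeakDerivC.contDiff_mul hψ).I_mul
    (p0.const_mul _) ((p1.add p2).const_mul _)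
    ((p3.const_mul Complex.I).ae_eq (Eventually.of_forall fun x => by ring))
  -- `key` is the form identity for `v = i ψ u`: the terms with `x²` and `ψ |u_x|²` drop out, being
  -- real multiples of `Re i = 0`.
  have e1 : ∀ x, inner ℝ (Complex.I * (ψ x * u.fn x)) (u.opA x) =
      -(ψ x * inner ℝ (u.fn x) (Complex.I * u.opA x)) := fun x => by
    simp only [inner_eq_re_add_im, Complex.mul_re, Complex.mul_im, Complex.I_re, Complex.I_im,
      Complex.ofReal_re, Complex.ofReal_im]
    ring
  have e2 : ∀ x : ℝ, inner ℝ (x * (Complex.I * (ψ x * u.fn x))) (x * u.fn x) = 0 := fun x => by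
    simp only [inner_eq_re_add_im, Complex.mul_re, Complex.mul_im, Complex.I_re, Complex.I_im,
      Complex.ofReal_re, Complex.ofReal_im]
    ring
  have e3 : ∫ x, inner ℝ (Complex.I * (deriv ψ x * u.fn x + ψ x * u.dx x)) (u.dx x) =
      ∫ x, deriv ψ x * inner ℝ ((Complex.I • u.fn : L2 ℂ) x) (u.dx x) := by
    refine integral_congr_ae ?_
    filter_upwards [Lp.coeFn_smul Complex.I u.fn] with x hx
    rw [hx]
    simp only [inner_eq_re_add_im, Complex.mul_re, Complex.mul_im, Complex.I_re, Complex.I_im,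
      Complex.ofReal_re, Complex.ofReal_im, Pi.smul_apply, smul_eq_mul, Complex.add_re,
      Complex.add_im]
    ring
  simp only [e1, e2] at key
  rw [e3, integral_neg, integral_zero, mul_zero, sub_zero, neg_inj] at key
  rw [key]
  have := abs_integral_mul_inner_le m1' hC (Complex.I • u.fn : L2 ℂ) u.dx
  rwa [norm_smul, Complex.norm_I, one_mul] at this

end Domain

/-- Differentiation of a quadratic expression `B(u, u)` along a curve which is continuous in a
space `X`, but differentiable only in a larger space `Y`. The symmetry of `B` makes up for the
lacking differentiability: `B(v, v) - B(u, u) = B(v + u, v - u)`. -/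
theorem hasDerivWithinAt_bilinear {X Y Z : Type*} [NormedAddCommGroup X] [NormedSpace ℝ X]
    [NormedAddCommGroup Y] [NormedSpace ℝ Y] [NormedAddCommGroup Z] [NormedSpace ℝ Z]
    (B : X →L[ℝ] Y →L[ℝ] Z) (i : X →L[ℝ] Y) (hB : ∀ x y, B x (i y) = B y (i x))
    {u : ℝ → X} {u' : Y} {S : Set ℝ} {t : ℝ} (hc : ContinuousWithinAt u S t)
    (hd : HasDerivWithinAt (fun s => i (u s)) u' S t) :
    HasDerivWithinAt (fun s => B (u s) (i (u s))) ((2 : ℝ) • B (u t) u') S t := by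
  rw [hasDerivWithinAt_iff_tendsto_slope] at hd ⊢
  have h1 : Tendsto (fun s => B (u s + u t)) (𝓝[S \ {t}] t) (𝓝 (B (u t + u t))) :=
    (B.continuous.tendsto _).comp ((hc.mono sdiff_subset).add_const (u t))
  have h2 := (isBoundedBilinearMap_apply (𝕜 := ℝ) (E := Y) (F := Z)).continuous.tendsto
    (B (u t + u t), u') |>.comp (h1.prodMk_nhds hd)
  have e : B (u t + u t) u' = (2 : ℝ) • B (u t) u' := by
    rw [map_add, add_apply, two_smul]
  simp only [e] at h2
  refine h2.congr fun s => ?_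
  simp only [Function.comp_apply, slope_def_module, map_smul, map_sub, map_add, add_apply]
  rw [hB (u t) (u s)]
  congr 1
  abel

/-! ### Balance laws for mass and energy -/

section SobolevProjections

variable {E : Type} [NormedAddCommGroup E] [NormedSpace ℝ E] {k : ℕ}

/-- The `j`-th weak derivative as a continuous linear map from `Hᵏ` to `L²`. -/
noncomputable def Sobolev.DL (E : Type) [NormedAddCommGroup E] [NormedSpace ℝ E] (k : ℕ)
    (j : Fin (k + 1)) : Sobolev E k →L[ℝ] L2 E :=
  (PiLp.proj 2 (fun _ : Fin (k + 1) => L2 E) j).comp (sobolevTuples E k).subtypeL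

theorem Sobolev.hasDerivWithinAt_D {F : ℝ → Sobolev E k} {F' : Sobolev E k} {S : Set ℝ} {t : ℝ}
    (h : HasDerivWithinAt F F' S t) (j : Fin (k + 1)) :
    HasDerivWithinAt (fun s => (F s).D j) (F'.D j) S t :=
  (Sobolev.DL E k j).hasFDerivAt.comp_hasDerivWithinAt t h

theorem Sobolev.norm_sq_eq (F : Sobolev E 1) : ‖F‖ ^ 2 = ‖F.D 0‖ ^ 2 + ‖F.D 1‖ ^ 2 := by
  have := PiLp.norm_sq_eq_of_L2 (fun _ : Fin 2 => L2 E) F.1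
  rw [Fin.sum_univ_two] at this
  exact this

/-- An `H¹` bound controls the function and its weak derivative. -/
theorem norm_le_of_sobolevNorm_le [CompleteSpace E] {f g : L2 E} (h : IsWeakDeriv f g) {M : ℝ≥0}
    (hM : sobolevNorm 1 f ≤ M) : ‖f‖ ≤ M ∧ ‖g‖ ≤ M := by
  let F : Sobolev E 1 := ⟨WithLp.toLp 2 ![f, g], fun j => by
    have : j = 0 := Subsingleton.elim _ _
    subst this
    exact h⟩
  have h0 : F.D 0 = f := rfl
  have h1 : F.D 1 = g := rfl
  have key : ‖F‖ₑ ≤ M := by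
    refine le_trans (le_iInf₂ fun G hG => ?_) hM
    have hG0 : G.D 0 = f := hG
    have hG1 : G.D 1 = g := by
      have := G.2 0
      change IsWeakDeriv (G.D 0) (G.D 1) at this
      rw [hG0] at this
      exact this.unique h
    have e : ‖G‖ ^ 2 = ‖F‖ ^ 2 := by
      rw [Sobolev.norm_sq_eq, Sobolev.norm_sq_eq, hG0, hG1, h0, h1]
    rw [pow_left_inj₀ (norm_nonneg _) (norm_nonneg _) two_ne_zero] at e
    rw [← ofReal_norm, ← ofReal_norm, e]
  have key' : ‖F‖ ≤ M := by
    rw [enorm_eq_nnnorm] at key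
    exact_mod_cast key
  have e := F.norm_sq_eq
  rw [h0, h1] at e
  constructor <;> refine le_trans (le_of_sq_le_sq ?_ (norm_nonneg F)) key'
  · nlinarith [sq_nonneg ‖g‖]
  · nlinarith [sq_nonneg ‖f‖]

end SobolevProjections

/-- `ψ` is a smooth weight with values in `[0, 1]` and slope at most `C`. -/
structure IsWeight (ψ : ℝ → ℝ) (C : ℝ) : Prop where
  contDiff : ContDiff ℝ ∞ ψ
  nonneg : ∀ x, 0 ≤ ψ x
  le_one : ∀ x, ψ x ≤ 1
  abs_deriv_le : ∀ x, |deriv ψ x| ≤ C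

theorem IsWeight.abs_le {ψ : ℝ → ℝ} {C : ℝ} (h : IsWeight ψ C) (x : ℝ) : |ψ x| ≤ 1 :=
  _root_.abs_le.2 ⟨by linarith [h.nonneg x], h.le_one x⟩

theorem IsWeight.memLp {ψ : ℝ → ℝ} {C : ℝ} (h : IsWeight ψ C) : MemLp ψ ∞ :=
  memLp_top_of_bound h.contDiff.continuous.aestronglyMeasurable 1 (Eventually.of_forall h.abs_le)

theorem IsWeight.memLp_deriv {ψ : ℝ → ℝ} {C : ℝ} (h : IsWeight ψ C) : MemLp (deriv ψ) ∞ :=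
  memLp_top_of_bound (h.contDiff.continuous_deriv (by simp)).aestronglyMeasurable C
    (Eventually.of_forall h.abs_deriv_le)

theorem IsWeight.one : IsWeight (fun _ => 1) 0 :=
  ⟨contDiff_const, fun _ => zero_le_one, fun _ => le_rfl, fun x => by simp⟩

/-- `∫ ψ |f|²`. -/
noncomputable def weightedSq {E : Type} [NormedAddCommGroup E] [InnerProductSpace ℝ E]
    (ψ : ℝ → ℝ) (f : L2 E) : ℝ := ∫ x, ψ x * inner ℝ (f x) (f x)

section WeightedSq

variable {E : Type} [NormedAddCommGroup E] [InnerProductSpace ℝ E]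

theorem weightedSq_one (f : L2 E) : weightedSq (fun _ => 1) f = ‖f‖ ^ 2 := by
  rw [← real_inner_self_eq_norm_sq, L2.inner_def]
  simp [weightedSq]

theorem IsWeight.weightedSq_nonneg {ψ : ℝ → ℝ} {C : ℝ} (h : IsWeight ψ C) (f : L2 E) :
    0 ≤ weightedSq ψ f :=
  integral_nonneg fun x => mul_nonneg (h.nonneg x) real_inner_self_nonneg

theorem weightedSq_eq_zero {ψ : ℝ → ℝ} {f : L2 E} {S : Set ℝ} (hf : VanishesOff f S)
    (h0 : ∀ x ∈ S, ψ x = 0) : weightedSq ψ f = 0 := by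
  refine integral_eq_zero_of_ae ?_
  filter_upwards [hf] with x hx
  by_cases hxS : x ∈ S
  · simp [h0 x hxS]
  · simp [hx hxS]

end WeightedSq

section Evolution

variable {α a b H : ℝ} {u₀ : DomA H} {ρ₀ : Sobolev ℝ 3} {ρ₁ : Sobolev ℝ 2}
  {u : ℝ → DomA H} {ut : ℝ → L2 ℂ} {ρ : ℝ → Sobolev ℝ 3} {ρt : ℝ → Sobolev ℝ 2}
  {ρtt : ℝ → Sobolev ℝ 1}

/-- The density `|u|²` of an element of `D(A)`, as an `L²` function. -/
noncomputable def DomA.density (u : DomA H) : L2 ℝ := DomA.innerL H u u.fn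

theorem DomA.coeFn_density (u : DomA H) : u.density =ᵐ[volume] fun x => ‖u.fn x‖ ^ 2 := by
  filter_upwards [u.coeFn_innerL u.fn] with x hx
  exact hx.trans (real_inner_self_eq_norm_sq _)

theorem IsWeight.integral_sq_mul_density_le {ψ : ℝ → ℝ} {C : ℝ} (hψ : IsWeight ψ C) (u : DomA H) :
    ∫ x, (ψ x * u.density x) ^ 2 ≤ 4 * ‖u.fn‖ * ‖u.dx‖ * weightedSq ψ u.fn := by
  rw [weightedSq, ← integral_const_mul]
  refine integral_mono_of_nonneg (Eventually.of_forall fun x => sq_nonneg _)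
    ((integrable_mul_inner hψ.memLp u.fn u.fn).const_mul _) ?_
  filter_upwards [u.coeFn_density, u.isWeakDeriv_dx.norm_sq_le] with x h1 h2
  rw [h1, real_inner_self_eq_norm_sq]
  have h3 : 0 ≤ ψ x * ‖u.fn x‖ ^ 2 := mul_nonneg (hψ.nonneg x) (sq_nonneg _)
  have h4 : ψ x * ‖u.fn x‖ ^ 2 ≤ 4 * ‖u.fn‖ * ‖u.dx‖ :=
    (mul_le_of_le_one_left (sq_nonneg _) (hψ.le_one x)).trans h2
  rw [sq]
  exact mul_le_mul_of_nonneg_right h4 h3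

theorem DomA.norm_density_sq_le (u : DomA H) :
    ‖u.density‖ ^ 2 ≤ 4 * ‖u.fn‖ * ‖u.dx‖ * ‖u.fn‖ ^ 2 := by
  have h := IsWeight.one.integral_sq_mul_density_le u
  rw [weightedSq_one] at h
  refine le_trans (le_of_eq ?_) h
  rw [← real_inner_self_eq_norm_sq, L2.inner_def]
  simp [sq]

namespace IsGlobalSolution

/-- The local mass balance: `∂ₜ|u|² = 2 Re (ū i A u)`, as the potential terms are real. -/
theorem hasDerivWithinAt_weightedSq_u (h : IsGlobalSolution α a b H u₀ ρ₀ ρ₁ u ut ρ ρt ρtt)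
    {ψ : ℝ → ℝ} {C : ℝ} (hψ : IsWeight ψ C) {t : ℝ} (ht : t ∈ Ici (0 : ℝ)) :
    HasDerivWithinAt (fun s => weightedSq ψ (u s).fn)
      (2 * ∫ x, ψ x * inner ℝ ((u t).fn x) (Complex.I * (u t).opA x)) (Ici 0) t := by
  have h1 := hasDerivWithinAt_integral_mul_inner hψ.memLp (h.hasDeriv_u t ht)
  have e : ∫ x, ψ x * inner ℝ ((u t).fn x) (ut t x) =
      ∫ x, ψ x * inner ℝ ((u t).fn x) (Complex.I * (u t).opA x) := by
    refine integral_congr_ae ?_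
    filter_upwards [h.schrodinger t ht] with x hx
    have hr := congrArg Complex.re hx
    have hi := congrArg Complex.im hx
    simp only [← Complex.ofReal_neg, ← Complex.ofReal_mul, Complex.add_re, Complex.add_im,
      Complex.re_ofReal_mul, Complex.im_ofReal_mul, Complex.I_mul_re, Complex.I_mul_im] at hr hi
    simp only [inner_eq_re_add_im, Complex.I_mul_re, Complex.I_mul_im]
    linear_combination ψ x * ((u t).fn x).re * hi - ψ x * ((u t).fn x).im * hr
  rw [e] at h1
  exact h1

theorem norm_sub_weightedSq_u_le (h : IsGlobalSolution α a b H u₀ ρ₀ ρ₁ u ut ρ ρt ρtt)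
    {ψ : ℝ → ℝ} {C : ℝ} (hψ : IsWeight ψ C) {K t : ℝ} (ht : t ∈ Ici (0 : ℝ))
    (hK : ∀ s ∈ Ici (0 : ℝ), 2 * (C * ‖(u s).fn‖ * ‖(u s).dx‖) ≤ K) :
    |weightedSq ψ (u t).fn - weightedSq ψ (u 0).fn| ≤ K * t := by
  have := Convex.norm_image_sub_le_of_norm_hasDerivWithin_le (C := K)
    (fun s hs => h.hasDerivWithinAt_weightedSq_u hψ hs) (fun s hs => ?_) (convex_Ici 0)
    self_mem_Ici ht
  · rwa [sub_zero, Real.norm_eq_abs, Real.norm_eq_abs, abs_of_nonneg (a := t) ht] at this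
  · rw [Real.norm_eq_abs, abs_mul, abs_two]
    refine le_trans ?_ (hK s hs)
    exact mul_le_mul_of_nonneg_left ((u s).abs_integral_mul_inner_I_opA_le hψ.contDiff hψ.abs_le
      hψ.abs_deriv_le) zero_le_two

/-- Conservation of mass. -/
theorem norm_u_eq (h : IsGlobalSolution α a b H u₀ ρ₀ ρ₁ u ut ρ ρt ρtt) {t : ℝ}
    (ht : t ∈ Ici (0 : ℝ)) : ‖(u t).fn‖ = ‖(u 0).fn‖ := by
  have := h.norm_sub_weightedSq_u_le IsWeight.one (K := 0) ht fun s _ => by simp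
  rw [zero_mul, weightedSq_one, weightedSq_one] at this
  rw [← pow_left_inj₀ (norm_nonneg _) (norm_nonneg _) two_ne_zero]
  exact sub_eq_zero.1 (abs_nonpos_iff.1 this)

theorem hasDerivWithinAt_ρ (h : IsGlobalSolution α a b H u₀ ρ₀ ρ₁ u ut ρ ρt ρtt) {t : ℝ}
    (ht : t ∈ Ici (0 : ℝ)) : HasDerivWithinAt (fun s => (ρ s).fn) (ρt t).fn (Ici 0) t :=
  Sobolev.hasDerivWithinAt_D (h.hasDeriv_ρ t ht) 0

theorem hasDerivWithinAt_ρx (h : IsGlobalSolution α a b H u₀ ρ₀ ρ₁ u ut ρ ρt ρtt) {t : ℝ}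
    (ht : t ∈ Ici (0 : ℝ)) : HasDerivWithinAt (fun s => (ρ s).D 1) ((ρt t).D 1) (Ici 0) t :=
  Sobolev.hasDerivWithinAt_D (h.hasDeriv_ρ t ht) 1

theorem hasDerivWithinAt_ρt (h : IsGlobalSolution α a b H u₀ ρ₀ ρ₁ u ut ρ ρt ρtt) {t : ℝ}
    (ht : t ∈ Ici (0 : ℝ)) : HasDerivWithinAt (fun s => (ρt s).fn) (ρtt t).fn (Ici 0) t :=
  Sobolev.hasDerivWithinAt_D (h.hasDeriv_ρt t ht) 0

/-- Twice the energy of the wave equation, localized by the weight `ψ`. -/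
noncomputable def _root_.LiquidCrystal.waveEnergy (α b : ℝ) (ψ : ℝ → ℝ) (r r' s : L2 ℝ) : ℝ :=
  weightedSq ψ s + α * weightedSq ψ r' + b * weightedSq ψ r

/-- The local energy balance of the wave equation, with source `|u|²` and flux `-α ρ_x ρ_t`. -/
theorem hasDerivWithinAt_waveEnergy (h : IsGlobalSolution α a b H u₀ ρ₀ ρ₁ u ut ρ ρt ρtt)
    {ψ : ℝ → ℝ} {C : ℝ} (hψ : IsWeight ψ C) {t : ℝ} (ht : t ∈ Ici (0 : ℝ)) :
    HasDerivWithinAt (fun s => waveEnergy α b ψ (ρ s).fn ((ρ s).D 1) (ρt s).fn)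
      (2 * (∫ x, ψ x * inner ℝ ((u t).density x) ((ρt t).fn x)) -
        2 * α * ∫ x, deriv ψ x * inner ℝ ((ρ t).D 1 x) ((ρt t).fn x)) (Ici 0) t := by
  have h1 := hasDerivWithinAt_integral_mul_inner hψ.memLp (h.hasDerivWithinAt_ρ ht)
  have h2 := hasDerivWithinAt_integral_mul_inner hψ.memLp (h.hasDerivWithinAt_ρx ht)
  have h3 := hasDerivWithinAt_integral_mul_inner hψ.memLp (h.hasDerivWithinAt_ρt ht)
  refine ((h3.add (h2.const_mul α)).add (h1.const_mul b)).congr_deriv ?_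
  have w1 : IsWeakDeriv ((ρ t).D 1) ((ρ t).D 2) := (ρ t).2 1
  have w2 : IsWeakDeriv ((ρt t).fn) ((ρt t).D 1) := (ρt t).2 0
  have e1 := w1.integral_mul_eq w2 hψ.contDiff hψ.memLp hψ.memLp_deriv
  have i1 := integrable_mul_inner hψ.memLp (ρt t).fn (ρtt t).fn
  have i2 := integrable_mul_inner hψ.memLp ((ρ t).D 2) (ρt t).fn
  have i3 := integrable_mul_inner hψ.memLp (ρ t).fn (ρt t).fn
  have e2 : ∫ x, ψ x * inner ℝ ((u t).density x) ((ρt t).fn x) =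
      ∫ x, (ψ x * inner ℝ ((ρt t).fn x) ((ρtt t).fn x) -
        α * (ψ x * inner ℝ ((ρ t).D 2 x) ((ρt t).fn x)) +
        b * (ψ x * inner ℝ ((ρ t).fn x) ((ρt t).fn x))) := by
    refine integral_congr_ae ?_
    filter_upwards [h.wave t ht, (u t).coeFn_density] with x hx hd
    rw [hd]
    simp only [inner_eq_mul, hx]
    ring
  have i4 : Integrable fun x => ψ x * inner ℝ ((ρt t).fn x) ((ρtt t).fn x) -
      α * (ψ x * inner ℝ ((ρ t).D 2 x) ((ρt t).fn x)) := i1.sub (i2.const_mul α)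
  rw [integral_add i4 (i3.const_mul b), integral_sub i1 (i2.const_mul α), integral_const_mul,
    integral_const_mul] at e2
  simp only [inner_eq_mul] at e2 ⊢
  linear_combination 2 * α * e1 - 2 * e2

/-- The conserved energy of the system. -/
noncomputable def _root_.LiquidCrystal.energy (α a b : ℝ) (v : DomA H) (r r' s : L2 ℝ) : ℝ :=
  -inner ℝ v.fn v.opA + a / 2 * ‖v.density‖ ^ 2 - inner ℝ r v.density +
    1 / 2 * waveEnergy α b (fun _ => 1) r r' s

theorem hasDerivWithinAt_density (h : IsGlobalSolution α a b H u₀ ρ₀ ρ₁ u ut ρ ρt ρtt)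
    {t : ℝ} (ht : t ∈ Ici (0 : ℝ)) :
    HasDerivWithinAt (fun s => (u s).density) ((2 : ℝ) • DomA.innerL H (u t) (ut t)) (Ici 0) t :=
  hasDerivWithinAt_bilinear (DomA.innerL H) (DomA.fnL H) (fun v w => by
    refine Lp.ext ?_
    filter_upwards [v.coeFn_innerL w.fn, w.coeFn_innerL v.fn] with x h1 h2
    exact h1.trans ((real_inner_comm _ _).trans h2.symm))
    (h.continuousOn_u t ht) (h.hasDeriv_u t ht)

theorem hasDerivWithinAt_inner_opA (h : IsGlobalSolution α a b H u₀ ρ₀ ρ₁ u ut ρ ρt ρtt)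
    {t : ℝ} (ht : t ∈ Ici (0 : ℝ)) :
    HasDerivWithinAt (fun s => inner ℝ (u s).fn (u s).opA) (2 * inner ℝ (u t).opA (ut t))
      (Ici 0) t := by
  have key := hasDerivWithinAt_bilinear (DomA.formL H) (DomA.fnL H) (fun v w => by
    change inner ℝ v.opA w.fn = inner ℝ w.opA v.fn
    rw [real_inner_comm, DomA.inner_opA_comm, real_inner_comm])
    (h.continuousOn_u t ht) (h.hasDeriv_u t ht)
  refine key.congr (fun s _ => ?_) ?_ <;> exact real_inner_comm _ _

/-- The Schrödinger equation paired with `u_t`; the term `⟨i u_t, u_t⟩` vanishes. -/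
theorem inner_opA_ut (h : IsGlobalSolution α a b H u₀ ρ₀ ρ₁ u ut ρ ρt ρtt)
    {t : ℝ} (ht : t ∈ Ici (0 : ℝ)) :
    inner ℝ (u t).opA (ut t) = a * inner ℝ (u t).density (DomA.innerL H (u t) (ut t)) -
      inner ℝ (ρ t).fn (DomA.innerL H (u t) (ut t)) := by
  simp only [L2.inner_def]
  rw [← integral_const_mul, ← integral_sub
    ((L2.integrable_inner (𝕜 := ℝ) _ _).const_mul a) (L2.integrable_inner (𝕜 := ℝ) _ _)]
  refine integral_congr_ae ?_
  filter_upwards [h.schrodinger t ht, (u t).coeFn_density, (u t).coeFn_innerL (ut t)]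
    with x hx h1 h2
  rw [h1, h2]
  have hr := congrArg Complex.re hx
  have hi := congrArg Complex.im hx
  simp only [← Complex.ofReal_neg, ← Complex.ofReal_mul, Complex.add_re, Complex.add_im,
    Complex.re_ofReal_mul, Complex.im_ofReal_mul, Complex.I_mul_re, Complex.I_mul_im] at hr hi
  simp only [inner_eq_re_add_im, inner_eq_mul]
  linear_combination (ut t x).re * hr + (ut t x).im * hi

/-- Conservation of energy. -/
theorem energy_eq (h : IsGlobalSolution α a b H u₀ ρ₀ ρ₁ u ut ρ ρt ρtt) {t : ℝ}
    (ht : t ∈ Ici (0 : ℝ)) : energy α a b (u t) (ρ t).fn ((ρ t).D 1) (ρt t).fn =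
      energy α a b (u 0) (ρ 0).fn ((ρ 0).D 1) (ρt 0).fn := by
  have key : ∀ s ∈ Ici (0 : ℝ), HasDerivWithinAt
      (fun s => energy α a b (u s) (ρ s).fn ((ρ s).D 1) (ρt s).fn) 0 (Ici 0) s := fun s hs => by
    have h1 := h.hasDerivWithinAt_inner_opA hs
    have h2 := h.hasDerivWithinAt_density hs
    have h3 := (h.hasDerivWithinAt_ρ hs).inner ℝ h2
    have h4 := h.hasDerivWithinAt_waveEnergy IsWeight.one hs
    refine (((h1.neg.add (h2.norm_sq.const_mul (a / 2))).sub h3).add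
      (h4.const_mul (1 / 2))).congr_deriv ?_
    have e : ∫ x, 1 * inner ℝ ((u s).density x) ((ρt s).fn x) =
        inner ℝ (ρt s).fn (u s).density := by
      rw [L2.inner_def]
      simp only [one_mul, real_inner_comm]
    rw [e]
    simp only [deriv_const, zero_mul, integral_zero, mul_zero, real_inner_smul_right]
    linear_combination -2 * h.inner_opA_ut hs
  have := Convex.norm_image_sub_le_of_norm_hasDerivWithin_le (C := 0) key
    (fun s _ => by simp) (convex_Ici 0) self_mem_Ici ht
  rw [zero_mul] at this
  exact sub_eq_zero.1 (norm_le_zero_iff.1 this)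

end IsGlobalSolution

end Evolution

/-! ### Weights, uniform bounds and the tail estimate -/

theorem exists_abs_deriv_smoothTransition_le :
    ∃ K : ℝ, 0 < K ∧ ∀ x, |deriv Real.smoothTransition x| ≤ K := by
  have hs : ContDiff ℝ ∞ Real.smoothTransition := Real.smoothTransition.contDiff
  obtain ⟨K, hK⟩ := isCompact_Icc.exists_bound_of_continuousOn
    (hs.continuous_deriv (by simp)).continuousOn (s := Icc (0 : ℝ) 1)
  refine ⟨max K 1, by positivity, fun x => ?_⟩
  by_cases hx : x ∈ Icc (0 : ℝ) 1
  · exact (hK x hx).trans (le_max_left _ _)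
  have h0 : deriv Real.smoothTransition x = 0 := by
    rcases lt_or_ge x 0 with h | h
    · have : Real.smoothTransition =ᶠ[𝓝 x] fun _ => 0 := by
        filter_upwards [Iio_mem_nhds h] with y hy
        exact Real.smoothTransition.zero_of_nonpos (le_of_lt hy)
      simp [this.deriv_eq]
    · have h1 : 1 < x := not_le.1 fun h2 => hx ⟨h, h2⟩
      have : Real.smoothTransition =ᶠ[𝓝 x] fun _ => 1 := by
        filter_upwards [Ioi_mem_nhds h1] with y hy
        exact Real.smoothTransition.one_of_one_le (le_of_lt hy)
      simp [this.deriv_eq]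
  rw [h0, abs_zero]
  positivity

/-- Weights with arbitrarily small slope which separate `]-θ, θ[` from the complement of a large
interval. -/
theorem exists_isWeight {θ C : ℝ} (hθ : 0 < θ) (hC : 0 < C) :
    ∃ δ : ℝ, 0 < δ ∧ ∃ ψ : ℝ → ℝ, IsWeight ψ C ∧ (∀ x ∈ Ioo (-θ) θ, ψ x = 0) ∧
      ∀ x, θ + δ ≤ |x| → ψ x = 1 := by
  obtain ⟨K, hK, hd⟩ := exists_abs_deriv_smoothTransition_le
  have hs : ContDiff ℝ ∞ Real.smoothTransition := Real.smoothTransition.contDiff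
  -- The factor `2` allows for the two summands of `ψ`.
  set δ := 2 * K / C with hδ
  have hδ0 : 0 < δ := by positivity
  let σ := Real.smoothTransition
  let ψ : ℝ → ℝ := fun x => σ ((x - θ) / δ) + σ ((-x - θ) / δ)
  have left0 : ∀ x, x ≤ θ → σ ((x - θ) / δ) = 0 := fun x hx =>
    Real.smoothTransition.zero_of_nonpos (div_nonpos_of_nonpos_of_nonneg (by linarith) hδ0.le)
  have right1 : ∀ x, θ + δ ≤ x → σ ((x - θ) / δ) = 1 := fun x hx =>
    Real.smoothTransition.one_of_one_le ((one_le_div hδ0).2 (by linarith))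
  have hder : ∀ x, HasDerivAt ψ (deriv σ ((x - θ) / δ) * (1 / δ) +
      deriv σ ((-x - θ) / δ) * (-1 / δ)) x := fun x => by
    have d : ∀ y, HasDerivAt σ (deriv σ y) y := fun y =>
      (hs.differentiable (by simp) y).hasDerivAt
    have l1 : HasDerivAt (fun x => (x - θ) / δ) (1 / δ) x :=
      ((hasDerivAt_id x).sub_const θ).div_const δ
    have l2 : HasDerivAt (fun x => (-x - θ) / δ) (-1 / δ) x :=
      ((hasDerivAt_id x).neg.sub_const θ).div_const δ
    exact ((d _).comp x l1).add ((d _).comp x l2)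
  refine ⟨δ, hδ0, ψ, ⟨?_, fun x => ?_, fun x => ?_, fun x => ?_⟩, fun x hx => ?_, fun x hx => ?_⟩
  · exact (hs.comp (by fun_prop)).add (hs.comp (by fun_prop))
  · exact add_nonneg (Real.smoothTransition.nonneg _) (Real.smoothTransition.nonneg _)
  · rcases le_total x 0 with h | h
    · simp only [ψ, left0 x (by linarith), zero_add]
      exact Real.smoothTransition.le_one _
    · simp only [ψ, left0 (-x) (by linarith), add_zero]
      exact Real.smoothTransition.le_one _
  · rw [(hder x).deriv]
    refine (abs_add_le _ _).trans ?_
    rw [abs_mul, abs_mul, neg_div, abs_neg, abs_of_pos (one_div_pos.2 hδ0)]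
    have h1 := mul_le_mul_of_nonneg_right (hd ((x - θ) / δ)) (one_div_pos.2 hδ0).le
    have h2 := mul_le_mul_of_nonneg_right (hd ((-x - θ) / δ)) (one_div_pos.2 hδ0).le
    have h3 : K * (1 / δ) + K * (1 / δ) = C := by
      rw [hδ]; field_simp; ring
    linarith
  · simp only [ψ, left0 x hx.2.le, left0 (-x) (by linarith [hx.1]), add_zero]
  · rcases le_total x 0 with h | h
    · rw [abs_of_nonpos h] at hx
      simp only [ψ, left0 x (by linarith), right1 (-x) hx, zero_add]
    · rw [abs_of_nonneg h] at hx
      simp only [ψ, left0 (-x) (by linarith), right1 x hx, add_zero]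

theorem le_abs_of_notMem_add_ball {θ δ x : ℝ} (hθ : 0 < θ) (hδ : 0 < δ)
    (hx : x ∉ Ioo (-θ) θ + Metric.ball (0 : ℝ) δ) : θ + δ ≤ |x| := by
  by_contra! h
  refine hx ?_
  have hs : 0 < θ + δ := by positivity
  have hq : |x / (θ + δ)| < 1 := by rwa [abs_div, abs_of_pos hs, div_lt_one hs]
  obtain ⟨q1, q2⟩ := abs_lt.1 hq
  -- Divide `x` in the ratio `θ : δ`.
  refine Set.mem_add.2 ⟨θ * (x / (θ + δ)), ⟨by nlinarith, by nlinarith⟩, δ * (x / (θ + δ)), ?_, ?_⟩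
  · rw [mem_ball_zero_iff, Real.norm_eq_abs, abs_mul, abs_of_pos hδ]
    nlinarith
  · rw [← add_mul]
    field_simp

/-- The bound on the energy of data supported in `]-θ, θ[` in terms of their norms. -/
noncomputable def energyBound (α a b H θ M R : ℝ) : ℝ :=
  M ^ 2 + H ^ 2 * θ ^ 2 * M ^ 2 + |a| / 2 * (4 * M ^ 4) + R * (2 * M ^ 2) +
    1 / 2 * (1 + α + b) * R ^ 2

/-- The resulting bound on `‖u_x‖²`, `‖ρ_t‖²` and `α ‖ρ_x‖²`, uniform in time. -/
noncomputable def uniformBound (α a b H θ M R : ℝ) : ℝ :=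
  2 * energyBound α a b H θ M R + ((|a| / 2 + 1 / (2 * b)) * (4 * M ^ 3)) ^ 2

theorem energy_le {α a b H θ M R : ℝ} (hα : 0 < α) (hb : 0 < b) (hM : 0 ≤ M) (hR : 0 ≤ R)
    {v : DomA H} {r r' s : L2 ℝ} (hv : ‖v.fn‖ ≤ M) (hv' : ‖v.dx‖ ≤ M) (hr : ‖r‖ ≤ R)
    (hr' : ‖r'‖ ≤ R) (hs : ‖s‖ ≤ R) (hsupp : VanishesOff v.fn (Ioo (-θ) θ)) :
    energy α a b v r r' s ≤ energyBound α a b H θ M R := by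
  have sq_le : ∀ {x y : ℝ}, 0 ≤ x → x ≤ y → x ^ 2 ≤ y ^ 2 := fun hx hxy =>
    pow_le_pow_left₀ hx hxy 2
  have n1 := sq_le (norm_nonneg _) hv
  have n2 := sq_le (norm_nonneg _) hv'
  have n3 := sq_le (norm_nonneg _) hr
  have n4 := sq_le (norm_nonneg _) hr'
  have n5 := sq_le (norm_nonneg _) hs
  have m1 : ∫ x : ℝ, x ^ 2 * ‖v.fn x‖ ^ 2 ≤ θ ^ 2 * M ^ 2 := by
    have e : ‖v.fn‖ ^ 2 = ∫ x, ‖v.fn x‖ ^ 2 := by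
      rw [← real_inner_self_eq_norm_sq, L2.inner_def]
      simp only [real_inner_self_eq_norm_sq]
    have i : Integrable fun x => ‖v.fn x‖ ^ 2 :=
      (L2.integrable_inner (𝕜 := ℝ) v.fn v.fn).congr
        (Eventually.of_forall fun x => real_inner_self_eq_norm_sq _)
    refine le_trans ?_ (mul_le_mul_of_nonneg_left n1 (sq_nonneg θ))
    rw [e, ← integral_const_mul]
    refine integral_mono_of_nonneg (Eventually.of_forall fun x => by positivity)
      (i.const_mul _) ?_
    filter_upwards [hsupp] with x hx
    by_cases hxS : x ∈ Ioo (-θ) θ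
    · refine mul_le_mul_of_nonneg_right ?_ (sq_nonneg _)
      nlinarith [hxS.1, hxS.2]
    · simp [hx hxS]
  have m2 : ‖v.density‖ ^ 2 ≤ 4 * M ^ 4 := by
    refine v.norm_density_sq_le.trans ?_
    have := mul_le_mul (mul_le_mul hv hv' (norm_nonneg _) hM) n1 (sq_nonneg _) (by positivity)
    nlinarith
  have m3 : ‖v.density‖ ≤ 2 * M ^ 2 := le_of_sq_le_sq (by nlinarith) (by positivity)
  have m4 : -inner ℝ r v.density ≤ R * (2 * M ^ 2) := (neg_le_abs _).trans
    ((abs_real_inner_le_norm _ _).trans (mul_le_mul hr m3 (norm_nonneg _) hR))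
  have m5 : a / 2 * ‖v.density‖ ^ 2 ≤ |a| / 2 * (4 * M ^ 4) :=
    mul_le_mul (by linarith [le_abs_self a]) m2 (sq_nonneg _) (by positivity)
  have m6 := mul_le_mul_of_nonneg_left m1 (sq_nonneg H)
  have m7 := mul_le_mul_of_nonneg_left n4 hα.le
  have m8 := mul_le_mul_of_nonneg_left n3 hb.le
  rw [energy, v.neg_inner_opA_self, waveEnergy, weightedSq_one, weightedSq_one, weightedSq_one,
    energyBound]
  linarith

/-- The energy controls the norms of `u_x`, `ρ_x` and `ρ_t`, because the nonlinear terms are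
sublinear in `‖u_x‖²` when the mass is bounded. -/
theorem norm_sq_le_of_energy_le {α a b H θ M R : ℝ} (hb : 0 < b)
    {v : DomA H} {r r' s : L2 ℝ} (hv : ‖v.fn‖ ≤ M)
    (hE : energy α a b v r r' s ≤ energyBound α a b H θ M R) :
    ‖v.dx‖ ^ 2 + ‖s‖ ^ 2 + α * ‖r'‖ ^ 2 ≤ uniformBound α a b H θ M R := by
  have hM : 0 ≤ M := (norm_nonneg _).trans hv
  set V := ‖v.density‖ with hV
  have m1 : V ^ 2 ≤ 4 * M ^ 3 * ‖v.dx‖ := by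
    refine v.norm_density_sq_le.trans ?_
    have h3 : ‖v.fn‖ ^ 3 ≤ M ^ 3 := pow_le_pow_left₀ (norm_nonneg _) hv 3
    nlinarith [mul_le_mul_of_nonneg_right h3 (norm_nonneg v.dx)]
  -- The coefficient `b / 2` of `‖r‖²` is the one available in the energy.
  have m2 : inner ℝ r v.density ≤ b / 2 * ‖r‖ ^ 2 + 1 / (2 * b) * V ^ 2 := by
    refine (real_inner_le_norm _ _).trans ?_
    have : 0 ≤ (b * ‖r‖ - V) ^ 2 / (2 * b) := by positivity
    have e : (b * ‖r‖ - V) ^ 2 / (2 * b) =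
        b / 2 * ‖r‖ ^ 2 + 1 / (2 * b) * V ^ 2 - ‖r‖ * V := by
      field_simp
      ring
    linarith
  have m3 : -(|a| / 2 * V ^ 2) ≤ a / 2 * V ^ 2 := by nlinarith [neg_abs_le a, sq_nonneg V]
  have m4 : (|a| / 2 + 1 / (2 * b)) * V ^ 2 ≤
      (|a| / 2 + 1 / (2 * b)) * (4 * M ^ 3) * ‖v.dx‖ := by
    rw [mul_assoc]
    exact mul_le_mul_of_nonneg_left m1 (by positivity)
  have m5 := v.norm_dx_sq_le
  rw [energy, waveEnergy, weightedSq_one, weightedSq_one, weightedSq_one] at hE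
  rw [uniformBound]
  set L := (|a| / 2 + 1 / (2 * b)) * (4 * M ^ 3)
  nlinarith [sq_nonneg (‖v.dx‖ - L)]

/-- The bound on the energy outside a neighbourhood of `]-θ, θ[` at time `t`, where `C` is the
slope of the weight. It tends to zero with `C`. -/
noncomputable def tailBound (α b t M K C : ℝ) : ℝ :=
  2 * C * M * √K * t +
    (1 + 1 / α + 1 / b) * (t * (2 * K * M * √(8 * C * t) + C * (1 + α) * K))

theorem exists_tailBound_le (α b t M K : ℝ) {ε : ℝ} (hε : 0 < ε) :
    ∃ C, 0 < C ∧ tailBound α b t M K C ≤ ε := by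
  have hc : Continuous (tailBound α b t M K) := by
    unfold tailBound
    fun_prop
  have h0 : tailBound α b t M K 0 = 0 := by simp [tailBound]
  have h := hc.tendsto 0
  rw [h0] at h
  have h1 : ∀ᶠ C in 𝓝[>] (0 : ℝ), tailBound α b t M K C < ε :=
    (h.eventually (gt_mem_nhds hε)).filter_mono nhdsWithin_le_nhds
  obtain ⟨C, h2, h3⟩ := (h1.and self_mem_nhdsWithin).exists
  exact ⟨C, h3, h2.le⟩

theorem weightedSq_eq_integral_sq (ψ : ℝ → ℝ) (f : L2 ℝ) :
    weightedSq ψ f = ∫ x, ψ x * f x ^ 2 := by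
  simp only [weightedSq, inner_eq_mul, sq]

section Tail

variable {α a b H : ℝ} {u₀ : DomA H} {ρ₀ : Sobolev ℝ 3} {ρ₁ : Sobolev ℝ 2}
  {u : ℝ → DomA H} {ut : ℝ → L2 ℂ} {ρ : ℝ → Sobolev ℝ 3} {ρt : ℝ → Sobolev ℝ 2}
  {ρtt : ℝ → Sobolev ℝ 1}

namespace IsGlobalSolution

/-- Propagation of mass and wave energy through the weight `ψ`. -/
theorem weightedSq_add_waveEnergy_le (h : IsGlobalSolution α a b H u₀ ρ₀ ρ₁ u ut ρ ρt ρtt)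
    (hα : 0 < α) (hb : 0 < b) {ψ : ℝ → ℝ} {C M K t : ℝ} (hψ : IsWeight ψ C) (hC : 0 < C)
    (ht : 0 < t) (hM : ∀ s ∈ Ici (0 : ℝ), ‖(u s).fn‖ ≤ M)
    (hK : ∀ s ∈ Ici (0 : ℝ),
      ‖(u s).dx‖ ^ 2 + ‖(ρt s).fn‖ ^ 2 + α * ‖(ρ s).D 1‖ ^ 2 ≤ K)
    (h0 : weightedSq ψ (u 0).fn = 0)
    (h1 : waveEnergy α b ψ (ρ 0).fn ((ρ 0).D 1) (ρt 0).fn = 0) :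
    weightedSq ψ (u t).fn + (1 + 1 / α + 1 / b) *
      waveEnergy α b ψ (ρ t).fn ((ρ t).D 1) (ρt t).fn ≤ tailBound α b t M K C := by
  have hM0 : 0 ≤ M := (norm_nonneg _).trans (hM 0 self_mem_Ici)
  have hK0 : 0 ≤ K := le_trans (by positivity) (hK 0 self_mem_Ici)
  have bu : ∀ s ∈ Ici (0 : ℝ), ‖(u s).dx‖ ≤ √K := fun s hs => Real.le_sqrt_of_sq_le (by
    nlinarith [hK s hs, sq_nonneg ‖(ρt s).fn‖, mul_nonneg hα.le (sq_nonneg ‖(ρ s).D 1‖)])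
  have bρ : ∀ s ∈ Ici (0 : ℝ), ‖(ρt s).fn‖ ≤ √K := fun s hs => Real.le_sqrt_of_sq_le (by
    nlinarith [hK s hs, sq_nonneg ‖(u s).dx‖, mul_nonneg hα.le (sq_nonneg ‖(ρ s).D 1‖)])
  have mass : ∀ s ∈ Ici (0 : ℝ), weightedSq ψ (u s).fn ≤ 2 * C * M * √K * s := fun s hs => by
    have := h.norm_sub_weightedSq_u_le hψ hs (K := 2 * C * M * √K) fun r hr => by
      have := mul_le_mul (hM r hr) (bu r hr) (norm_nonneg _) hM0
      nlinarith
    rw [h0, sub_zero] at this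
    exact (le_abs_self _).trans this
  have wave : waveEnergy α b ψ (ρ t).fn ((ρ t).D 1) (ρt t).fn ≤
      (2 * K * M * √(8 * C * t) + C * (1 + α) * K) * t := by
    have key := Convex.norm_image_sub_le_of_norm_hasDerivWithin_le
      (C := 2 * K * M * √(8 * C * t) + C * (1 + α) * K)
      (fun s (hs : s ∈ Icc 0 t) =>
        (h.hasDerivWithinAt_waveEnergy hψ hs.1).mono Icc_subset_Ici_self)
      (fun s hs => ?_) (convex_Icc 0 t) (left_mem_Icc.2 ht.le) (right_mem_Icc.2 ht.le)
    · rw [h1, sub_zero, sub_zero, Real.norm_eq_abs, Real.norm_eq_abs, abs_of_pos ht] at key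
      exact (le_abs_self _).trans key
    have hs0 : s ∈ Ici (0 : ℝ) := hs.1
    have d1 : ‖mulL2 ℝ hψ.memLp (u s).density‖ ≤ √K * (M * √(8 * C * t)) := by
      refine le_of_sq_le_sq ?_ (by positivity)
      have e : ‖mulL2 ℝ hψ.memLp (u s).density‖ ^ 2 = ∫ x, (ψ x * (u s).density x) ^ 2 := by
        rw [← real_inner_self_eq_norm_sq, L2.inner_def]
        refine integral_congr_ae ?_
        filter_upwards [coeFn_mulL2 hψ.memLp (u s).density] with x hx
        rw [hx, inner_eq_mul, smul_eq_mul, sq]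
      rw [e]
      refine (hψ.integral_sq_mul_density_le (u s)).trans ?_
      have k1 := mul_le_mul (hM s hs0) (bu s hs0) (norm_nonneg _) hM0
      have k2 : weightedSq ψ (u s).fn ≤ 2 * C * M * √K * t :=
        (mass s hs0).trans (mul_le_mul_of_nonneg_left hs.2 (by positivity))
      have k3 := mul_le_mul k1 k2 (hψ.weightedSq_nonneg _) (by positivity)
      rw [mul_pow, mul_pow, Real.sq_sqrt hK0, Real.sq_sqrt (by positivity)]
      have k4 : M * √K * (2 * C * M * √K * t) = 2 * (K * (M ^ 2 * (C * t))) := by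
        linear_combination 2 * C * M ^ 2 * t * Real.sq_sqrt hK0
      linarith
    have d2 : |∫ x, ψ x * inner ℝ ((u s).density x) ((ρt s).fn x)| ≤
        K * M * √(8 * C * t) := by
      rw [← inner_mulL2 hψ.memLp]
      refine (abs_real_inner_le_norm _ _).trans ?_
      refine (mul_le_mul d1 (bρ s hs0) (norm_nonneg _) (by positivity)).trans (le_of_eq ?_)
      linear_combination M * √(8 * C * t) * Real.sq_sqrt hK0
    -- `α ‖ρ_x‖ ‖ρ_t‖ ≤ (α² ‖ρ_x‖² + ‖ρ_t‖²) / 2 ≤ (α + 1) K / 2`.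
    have d3 : α * |∫ x, deriv ψ x * inner ℝ ((ρ s).D 1 x) ((ρt s).fn x)| ≤
        C * ((1 + α) / 2 * K) := by
      refine (mul_le_mul_of_nonneg_left (abs_integral_mul_inner_le hψ.memLp_deriv
        hψ.abs_deriv_le ((ρ s).D 1) (ρt s).fn) hα.le).trans ?_
      rw [mul_assoc, mul_left_comm]
      refine mul_le_mul_of_nonneg_left ?_ hC.le
      have k1 := hK s hs0
      have k2 : 0 ≤ α * ‖(ρ s).D 1‖ ^ 2 := by positivity
      have k3 : α * (α * ‖(ρ s).D 1‖ ^ 2) ≤ α * K := mul_le_mul_of_nonneg_left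
        (by linarith [sq_nonneg ‖(u s).dx‖, sq_nonneg ‖(ρt s).fn‖]) hα.le
      nlinarith [sq_nonneg (α * ‖(ρ s).D 1‖ - ‖(ρt s).fn‖), sq_nonneg ‖(u s).dx‖]
    rw [Real.norm_eq_abs]
    refine (abs_sub _ _).trans ?_
    rw [abs_mul, abs_mul, abs_mul, abs_two, abs_of_pos hα]
    linarith
  have hp : 0 ≤ 1 + 1 / α + 1 / b := by positivity
  have := mul_le_mul_of_nonneg_left wave hp
  rw [tailBound, mul_comm t]
  linarith [mass t ht.le]

end IsGlobalSolution

/-- The integral over a set on which the weight `ψ` is `1`. -/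
theorem setIntegral_le_weightedSq {ψ : ℝ → ℝ} {C : ℝ} (hψ : IsWeight ψ C) (hα : 0 < α)
    (hb : 0 < b) {S : Set ℝ} (hS : MeasurableSet S) (h1 : ∀ x ∈ S, ψ x = 1) (v : L2 ℂ)
    (r r' s : L2 ℝ) :
    ∫ x in S, (‖v x‖ ^ 2 + r x ^ 2 + r' x ^ 2 + s x ^ 2) ≤
      weightedSq ψ v + (1 + 1 / α + 1 / b) * waveEnergy α b ψ r r' s := by
  have i1 : Integrable fun x => ψ x * ‖v x‖ ^ 2 := (integrable_mul_inner hψ.memLp v v).congr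
    (Eventually.of_forall fun x => by simp only [real_inner_self_eq_norm_sq])
  have i2 : ∀ f : L2 ℝ, Integrable fun x => ψ x * f x ^ 2 := fun f =>
    (integrable_mul_inner hψ.memLp f f).congr
      (Eventually.of_forall fun x => by simp only [inner_eq_mul, sq])
  have ev : weightedSq ψ v = ∫ x, ψ x * ‖v x‖ ^ 2 := by
    simp only [weightedSq, real_inner_self_eq_norm_sq]
  have step : ∫ x in S, (‖v x‖ ^ 2 + r x ^ 2 + r' x ^ 2 + s x ^ 2) ≤
      weightedSq ψ v + weightedSq ψ r + weightedSq ψ r' + weightedSq ψ s := by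
    have j1 : Integrable fun x => ψ x * ‖v x‖ ^ 2 + ψ x * r x ^ 2 := i1.add (i2 r)
    have j2 : Integrable fun x => ψ x * ‖v x‖ ^ 2 + ψ x * r x ^ 2 + ψ x * r' x ^ 2 :=
      j1.add (i2 r')
    have j3 : Integrable fun x => ψ x * ‖v x‖ ^ 2 + ψ x * r x ^ 2 + ψ x * r' x ^ 2 +
      ψ x * s x ^ 2 := j2.add (i2 s)
    rw [ev, weightedSq_eq_integral_sq, weightedSq_eq_integral_sq, weightedSq_eq_integral_sq,
      ← integral_add i1 (i2 r), ← integral_add j1 (i2 r'), ← integral_add j2 (i2 s)]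
    rw [setIntegral_congr_fun hS (g := fun x => ψ x * ‖v x‖ ^ 2 + ψ x * r x ^ 2 +
      ψ x * r' x ^ 2 + ψ x * s x ^ 2) fun x hx => by simp only [h1 x hx, one_mul]]
    refine setIntegral_le_integral j3 (Eventually.of_forall fun x => ?_)
    have := hψ.nonneg x
    positivity
  have p1 := hψ.weightedSq_nonneg r
  have p2 := hψ.weightedSq_nonneg r'
  have p3 := hψ.weightedSq_nonneg s
  have hα' : 0 < 1 / α := by positivity
  have hb' : 0 < 1 / b := by positivity
  have e1 : 1 / α * (α * weightedSq ψ r') = weightedSq ψ r' := by field_simp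
  have e2 : 1 / b * (b * weightedSq ψ r) = weightedSq ψ r := by field_simp
  have q1 : 0 ≤ α * weightedSq ψ r' := by positivity
  have q2 : 0 ≤ b * weightedSq ψ r := by positivity
  have q3 := mul_nonneg hα'.le p3
  have q4 := mul_nonneg hb'.le p3
  have q5 := mul_nonneg hα'.le q2
  have q6 := mul_nonneg hb'.le q1
  rw [waveEnergy]
  linarith

end Tail

end LiquidCrystal

open LiquidCrystal
theorem theorem3 (α a b H : ℝ) (hα : 0 < α) (hb : 0 < b) (hH : H ≠ 0)
    (θ : ℝ) (hθ : 0 < θ) (t : ℝ) (ht : 0 < t) (ε : ℝ) (hε : 0 < ε) (M R : ℝ≥0) :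
    ∃ δ : ℝ, 0 < δ ∧
      ∀ (u₀ : DomA H) (ρ₀ : Sobolev ℝ 3) (ρ₁ : Sobolev ℝ 2),
        sobolevNorm 1 u₀.fn ≤ (M : ℝ≥0∞) →
        sobolevNorm 1 ρ₀.fn ≤ (R : ℝ≥0∞) →
        ‖ρ₁.fn‖ ≤ (R : ℝ) →
        VanishesOff u₀.fn (Ioo (-θ) θ) →
        VanishesOff ρ₀.fn (Ioo (-θ) θ) →
        VanishesOff ρ₁.fn (Ioo (-θ) θ) →
        ∀ (u : ℝ → DomA H) (ut : ℝ → L2 ℂ)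
          (ρ : ℝ → Sobolev ℝ 3) (ρt : ℝ → Sobolev ℝ 2) (ρtt : ℝ → Sobolev ℝ 1),
          IsGlobalSolution α a b H u₀ ρ₀ ρ₁ u ut ρ ρt ρtt →
          ∫ x in (Ioo (-θ) θ + Metric.ball (0 : ℝ) δ)ᶜ,
            (‖(u t).fn x‖ ^ 2 + (ρ t).fn x ^ 2 + (ρ t).D 1 x ^ 2 + (ρt t).fn x ^ 2) ≤ ε := by
  obtain ⟨C, hC, hCε⟩ := exists_tailBound_le α b t M (uniformBound α a b H θ M R) hε
  obtain ⟨δ, hδ, ψ, hψ, hψ0, hψ1⟩ := exists_isWeight hθ hC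
  refine ⟨δ, hδ, fun u₀ ρ₀ ρ₁ hu₀ hρ₀ hρ₁ su sρ sρ₁ u ut ρ ρt ρtt h => ?_⟩
  obtain ⟨m1, m2⟩ := norm_le_of_sobolevNorm_le u₀.isWeakDeriv_dx hu₀
  have hw : IsWeakDeriv ρ₀.fn (ρ₀.D 1) := ρ₀.2 0
  obtain ⟨r1, r2⟩ := norm_le_of_sobolevNorm_le hw hρ₀
  have hM : ∀ s ∈ Ici (0 : ℝ), ‖(u s).fn‖ ≤ M := fun s hs => by
    rw [h.norm_u_eq hs, h.initial_u]
    exact m1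
  have hE : ∀ s ∈ Ici (0 : ℝ), energy α a b (u s) (ρ s).fn ((ρ s).D 1) (ρt s).fn ≤
      energyBound α a b H θ M R := fun s hs => by
    rw [h.energy_eq hs, h.initial_u, h.initial_ρ, h.initial_ρt]
    exact energy_le hα hb M.2 R.2 m1 m2 r1 r2 hρ₁ su
  refine le_trans ?_ hCε
  refine le_trans (setIntegral_le_weightedSq hψ hα hb ?_ (fun x hx => hψ1 x
    (le_abs_of_notMem_add_ball hθ hδ hx)) (u t).fn (ρ t).fn ((ρ t).D 1) (ρt t).fn) ?_
  · exact (isOpen_Ioo.add_right).measurableSet.compl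
  refine h.weightedSq_add_waveEnergy_le hα hb hψ hC ht hM
    (fun s hs => norm_sq_le_of_energy_le hb (hM s hs) (hE s hs)) ?_ ?_
  · rw [h.initial_u]
    exact weightedSq_eq_zero su hψ0
  · rw [h.initial_ρ, h.initial_ρt, waveEnergy, weightedSq_eq_zero sρ hψ0,
      weightedSq_eq_zero sρ₁ hψ0, mul_zero, zero_add, add_zero, mul_eq_zero]
    right
    refine integral_eq_zero_of_ae ?_
    filter_upwards [hw.ae_mul_eq_zero isOpen_Ioo sρ hψ.contDiff hψ0] with x hx
    rw [inner_eq_mul, ← mul_assoc, hx, zero_mul]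
    rfl
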